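/- Let $G$ be a finite undirected multigraph with $m$ edges, $X\subseteq V(G)$ and $c\ge 0$ an integer. For $A,B\subseteq V(G)$ let $E_G(A,B)$ be the set of edges with one end in $A$ and the other in $B$, let $\partial(A)=E_G(A,V(G)\setminus A)$, and put $k=|\partial(X)|$. A violating cut of $X$ (for connectivity-$c$ linkedness) is a partition $X=A\cup B$, $A\cap B=\emptyset$, with $$|E_G(A,B)|<\min\bigl(|\partial(A)\cap\partial(X)|,\;|\partial(B)\cap\partial(X)|,\;c\bigr),$$ and $X$ is connectivity-$c$ linked if it has no violating cut. (When $G$ consists of $X=S$ and of a set $\mathcal T=V(G)\setminus S$ of terminals, each joined to $S$ by exactly one edge and incident with no other edge, $k$ is the number of terminals.) Theorem. There is a deterministic algorithm that, given $(G,X,c)$, runs in time $2^{O(c^2)}\cdot k^2\cdot m$ and either returns a violating cut of $X$ or reports that no such cut exists, i.e. that $X$ is connectivity-$c$ linked; its answer is always correct. Precisely: there are one word-RAM program (unit-cost constants, addition, truncated subtraction, comparison and indirect addressing on $w$-bit words) and one constant $C$ such that for every input, given as a list of the ends of the edges, the indicator of $X$, the numbers of vertices $n$ and edges $m$, and $c$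 (all other memory cells being $0$), and for every word length $w\ge C\,(c^2+\lfloor\log_2(n+m)\rfloor+1)$ (where $\log_2 0$ is read as $0$), the program halts with a correct answer after at most $2^{C(c^2+1)}\cdot\max(k,1)^2\cdot\max(m,1)$ steps. -/

import Mathlib

open scoped Graph

/-! ### Cuts in finite multigraphs -/

namespace ViolatingCut

/-- `E_G(A, B)`: the edges of the multigraph `G` with one end in `A` and the other end in `B`. -/
def edgesBetween {α β : Type*} (G : Graph α β) (A B : Set α) : Set β :=
  {e | ∃ x ∈ A, ∃ y ∈ B, G.IsLink e x y}

/-- `∂(X) = E_G(X, V(G) \ X)`: the boundary edges of the vertex set `X`. -/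
def boundary {α β : Type*} (G : Graph α β) (X : Set α) : Set β :=
  edgesBetween G X (G.vertexSet \ X)

/-- `(A, B)` is a violating cut for connectivity-`c` linkedness of `X`: it is a partition
`X = A ∪ B`, `A ∩ B = ∅`, and
`|E_G(A, B)| < min (|∂(A) ∩ ∂(X)|, |∂(B) ∩ ∂(X)|, c)`. (All graphs below are finite.) -/
def IsViolatingCut {α β : Type*} (G : Graph α β) (c : ℕ) (X A B : Set α) : Prop :=
  A ∪ B = X ∧ Disjoint A B ∧
    (edgesBetween G A B).ncard <
      min (min (boundary G A ∩ boundary G X).ncard (boundary G B ∩ boundary G X).ncard) c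

/-- `X` is a connectivity-`c` linked set in `G`: no cut of `X` has fewer than
`min (|∂(A) ∩ ∂(X)|, |∂(B) ∩ ∂(X)|, c)` edges. -/
def IsConnectivityLinked {α β : Type*} (G : Graph α β) (c : ℕ) (X : Set α) : Prop :=
  ∀ A B : Set α, A ∪ B = X → Disjoint A B →
    min (min (boundary G A ∩ boundary G X).ncard (boundary G B ∩ boundary G X).ncard) c ≤
      (edgesBetween G A B).ncard

end ViolatingCut

/-! ### A deterministic word RAM

Programs are structured programs over finitely many registers and finitely many arrays, all of
whose entries are words of `w` bits. The primitive operations are constants, addition (modulo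
`2 ^ w`), truncated subtraction, comparison, and indirect reading and writing of array entries;
each of them costs one unit of time. -/

namespace WordRAM

/-- The memory: registers `reg 0, reg 1, …` and arrays `arr 0, arr 1, …`. -/
structure State where
  reg : ℕ → ℕ
  arr : ℕ → ℕ → ℕ

/-- Arithmetic expressions. `get a i` is the entry of array number `a` at index `i`. -/
inductive Expr where
  | lit (n : ℕ)
  | var (x : ℕ)
  | get (a : ℕ) (i : Expr)
  | add (e f : Expr)
  | sub (e f : Expr)

/-- The number of operations needed to evaluate an expression. -/
def Expr.cost : Expr → ℕ
  | .lit _ => 1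
  | .var _ => 1
  | .get _ i => i.cost + 1
  | .add e f => e.cost + f.cost + 1
  | .sub e f => e.cost + f.cost + 1

/-- The value of an expression for word length `w`. -/
def Expr.eval (w : ℕ) (s : State) : Expr → ℕ
  | .lit n => n % 2 ^ w
  | .var x => s.reg x
  | .get a i => s.arr a (i.eval w s)
  | .add e f => (e.eval w s + f.eval w s) % 2 ^ w
  | .sub e f => e.eval w s - f.eval w s

/-- Tests. -/
inductive Test where
  | lt (e f : Expr)
  | eq (e f : Expr)

/-- The number of operations needed to perform a test. -/
def Test.cost : Test → ℕ
  | .lt e f => e.cost + f.cost + 1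
  | .eq e f => e.cost + f.cost + 1

/-- The outcome of a test for word length `w`. -/
def Test.Holds (w : ℕ) (s : State) : Test → Prop
  | .lt e f => e.eval w s < f.eval w s
  | .eq e f => e.eval w s = f.eval w s

/-- Programs. `assign x e` is `reg x := e`; `put a i e` is `arr a [i] := e`. -/
inductive Prog where
  | skip
  | assign (x : ℕ) (e : Expr)
  | put (a : ℕ) (i e : Expr)
  | seq (p q : Prog)
  | ite (b : Test) (p q : Prog)
  | while (b : Test) (p : Prog)

/-- The state after writing `v` into register `x`. -/
def State.setReg (s : State) (x v : ℕ) : State :=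
  { s with reg := Function.update s.reg x v }

/-- The state after writing `v` into array `a` at index `i`. -/
def State.setArr (s : State) (a i v : ℕ) : State :=
  { s with arr := Function.update s.arr a (Function.update (s.arr a) i v) }

/-- `Exec w p s s' t`: with word length `w`, program `p` started in state `s` halts in state `s'`
after exactly `t` units of time. -/
inductive Exec (w : ℕ) : Prog → State → State → ℕ → Prop where
  | skip (s : State) : Exec w .skip s s 1
  | assign (s : State) (x : ℕ) (e : Expr) :
      Exec w (.assign x e) s (s.setReg x (e.eval w s)) (e.cost + 1)
  | put (s : State) (a : ℕ) (i e : Expr) :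
      Exec w (.put a i e) s (s.setArr a (i.eval w s) (e.eval w s)) (i.cost + e.cost + 1)
  | seq {p q : Prog} {s s' s'' : State} {t t' : ℕ} :
      Exec w p s s' t → Exec w q s' s'' t' → Exec w (.seq p q) s s'' (t + t')
  | ite_true {b : Test} {p q : Prog} {s s' : State} {t : ℕ} :
      b.Holds w s → Exec w p s s' t → Exec w (.ite b p q) s s' (b.cost + t)
  | ite_false {b : Test} {p q : Prog} {s s' : State} {t : ℕ} :
      ¬ b.Holds w s → Exec w q s s' t → Exec w (.ite b p q) s s' (b.cost + t)
  | while_true {b : Test} {p : Prog} {s s' s'' : State} {t t' : ℕ} :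
      b.Holds w s → Exec w p s s' t → Exec w (.while b p) s' s'' t' →
        Exec w (.while b p) s s'' (b.cost + t + t')
  | while_false {b : Test} {p : Prog} {s : State} :
      ¬ b.Holds w s → Exec w (.while b p) s s b.cost

end WordRAM

namespace ViolatingCut

/-- The input format. The multigraph `G` has vertices `0, …, n - 1` and edges `0, …, m - 1`.
Registers `0, 1, 2` hold `n, m, c`; array `0` and array `1` hold the two ends of every edge, in
either order; array `2` is the indicator of the vertex set `X`. Everything else is zero. -/
structure IsInput (n m c : ℕ) (G : Graph ℕ ℕ) (X : Set ℕ) (s : WordRAM.State) : Prop where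
  vertexSet_eq : G.vertexSet = Set.Iio n
  edgeSet_eq : G.edgeSet = Set.Iio m
  subset : X ⊆ G.vertexSet
  reg_zero : s.reg 0 = n
  reg_one : s.reg 1 = m
  reg_two : s.reg 2 = c
  reg_rest : ∀ x, 3 ≤ x → s.reg x = 0
  isLink : ∀ e < m, G.IsLink e (s.arr 0 e) (s.arr 1 e)
  ends_rest : ∀ e, m ≤ e → s.arr 0 e = 0 ∧ s.arr 1 e = 0
  mem : ∀ v ∈ X, s.arr 2 v = 1
  notMem : ∀ v ∉ X, s.arr 2 v = 0
  arr_rest : ∀ a, 3 ≤ a → ∀ i, s.arr a i = 0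

/-- The side `A` of the cut that a final state describes: the vertices of `X` that are marked
by a `1` in array `3`. The other side is `X \ A`. -/
def outputSide (X : Set ℕ) (s : WordRAM.State) : Set ℕ :=
  {v | v ∈ X ∧ s.arr 3 v = 1}

end ViolatingCut

namespace WordRAM

/-! ### Total correctness with a time bound -/

infixr:60 " ;; " => Prog.seq

instance Test.decidableHolds (w : ℕ) (s : State) : (b : Test) → Decidable (b.Holds w s)
  | .lt e f => inferInstanceAs (Decidable (e.eval w s < f.eval w s))
  | .eq e f => inferInstanceAs (Decidable (e.eval w s = f.eval w s))

@[simp] theorem State.setReg_reg (s : State) (x v y : ℕ) :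
    (s.setReg x v).reg y = if y = x then v else s.reg y := by
  simp [State.setReg, Function.update_apply]

@[simp] theorem State.setReg_arr (s : State) (x v : ℕ) : (s.setReg x v).arr = s.arr := rfl

@[simp] theorem State.setArr_reg (s : State) (a i v : ℕ) : (s.setArr a i v).reg = s.reg := rfl

@[simp] theorem State.setArr_arr (s : State) (a i v b : ℕ) :
    (s.setArr a i v).arr b = if b = a then Function.update (s.arr a) i v else s.arr b := by
  simp [State.setArr, Function.update_apply]

/-- From `s`, the program `p` halts within time `T` in a state that satisfies `Q`. -/
def WP (w : ℕ) (p : Prog) (s : State) (T : ℕ) (Q : State → Prop) : Prop :=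
  ∃ s' t, Exec w p s s' t ∧ t ≤ T ∧ Q s'

variable {w : ℕ} {p q : Prog} {b : Test} {s s' : State} {T T' : ℕ} {Q Q' : State → Prop}

theorem WP.mono (h : WP w p s T Q) (hT : T ≤ T') (hQ : ∀ s', Q s' → Q' s') : WP w p s T' Q' := by
  obtain ⟨s', t, he, ht, hq⟩ := h
  exact ⟨s', t, he, ht.trans hT, hQ _ hq⟩

theorem WP.seq (h : WP w p s T (fun s' => WP w q s' T' Q)) : WP w (p ;; q) s (T + T') Q := by
  obtain ⟨s', t, he, ht, s'', t', he', ht', hq⟩ := h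
  exact ⟨s'', t + t', .seq he he', by omega, hq⟩

theorem WP.ite (h₁ : b.Holds w s → WP w p s T Q) (h₂ : ¬ b.Holds w s → WP w q s T Q) :
    WP w (.ite b p q) s (b.cost + T) Q := by
  by_cases hb : b.Holds w s
  · obtain ⟨s', t, he, ht, hq⟩ := h₁ hb
    exact ⟨s', _, .ite_true hb he, by omega, hq⟩
  · obtain ⟨s', t, he, ht, hq⟩ := h₂ hb
    exact ⟨s', _, .ite_false hb he, by omega, hq⟩

/-- Loops whose bodies decrease a natural number. -/
theorem WP.loop (I : ℕ → State → Prop) (K : ℕ)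
    (h : ∀ r s, I r s → (¬ b.Holds w s ∧ Q s) ∨
      (b.Holds w s ∧ WP w p s K (fun s' => ∃ r' < r, I r' s'))) {r : ℕ} (hI : I r s) :
    WP w (.while b p) s ((b.cost + K) * r + b.cost) Q := by
  induction r using Nat.strong_induction_on generalizing s with
  | _ r ih =>
    rcases h r s hI with ⟨hb, hq⟩ | ⟨hb, s', t, he, ht, r', hr', hI'⟩
    · exact ⟨s, _, .while_false hb, by omega, hq⟩
    · obtain ⟨s'', t', he', ht', hq⟩ := ih r' hr' hI'
      refine ⟨s'', _, .while_true hb he he', ?_, hq⟩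
      have : (b.cost + K) * (r' + 1) ≤ (b.cost + K) * r := Nat.mul_le_mul_left _ hr'
      rw [mul_add] at this
      omega

/-- The effect of a program without loops. -/
def Prog.run (w : ℕ) : Prog → State → State
  | .skip, s => s
  | .assign x e, s => s.setReg x (e.eval w s)
  | .put a i e, s => s.setArr a (i.eval w s) (e.eval w s)
  | .seq p q, s => q.run w (p.run w s)
  | .ite b p q, s => if b.Holds w s then p.run w s else q.run w s
  | .while _ _, s => s

/-- The program has no loop. -/
def Prog.loopFree : Prog → Bool
  | .seq p q => p.loopFree && q.loopFree
  | .ite _ p q => p.loopFree && q.loopFree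
  | .while _ _ => false
  | _ => true

/-- A bound for the running time of a program without loops. -/
def Prog.maxCost : Prog → ℕ
  | .skip => 1
  | .assign _ e => e.cost + 1
  | .put _ i e => i.cost + e.cost + 1
  | .seq p q => p.maxCost + q.maxCost
  | .ite b p q => b.cost + max p.maxCost q.maxCost
  | .while _ _ => 0

theorem Prog.exec_run : ∀ (p : Prog) (_ : p.loopFree = true) (s : State),
    ∃ t ≤ p.maxCost, Exec w p s (p.run w s) t
  | .skip, _, s => ⟨1, le_rfl, .skip s⟩
  | .assign x e, _, s => ⟨_, le_rfl, .assign s x e⟩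
  | .put a i e, _, s => ⟨_, le_rfl, .put s a i e⟩
  | .seq p q, h, s => by
    simp only [Prog.loopFree, Bool.and_eq_true] at h
    obtain ⟨t, ht, he⟩ := p.exec_run h.1 s
    obtain ⟨t', ht', he'⟩ := q.exec_run h.2 (p.run w s)
    exact ⟨t + t', add_le_add ht ht', .seq he he'⟩
  | .ite b p q, h, s => by
    simp only [Prog.loopFree, Bool.and_eq_true] at h
    by_cases hb : b.Holds w s
    · obtain ⟨t, ht, he⟩ := p.exec_run h.1 s
      refine ⟨_, add_le_add_right (ht.trans (le_max_left _ _)) _, ?_⟩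
      simp only [Prog.run, if_pos hb]
      exact .ite_true hb he
    · obtain ⟨t, ht, he⟩ := q.exec_run h.2 s
      refine ⟨_, add_le_add_right (ht.trans (le_max_right _ _)) _, ?_⟩
      simp only [Prog.run, if_neg hb]
      exact .ite_false hb he
  | .while _ _, h, _ => by simp [Prog.loopFree] at h

theorem WP.of_run (hp : p.loopFree = true) (hT : p.maxCost ≤ T) (h : Q (p.run w s)) :
    WP w p s T Q := by
  obtain ⟨t, ht, he⟩ := p.exec_run hp s
  exact ⟨_, t, he, ht.trans hT, h⟩

/-- The registers that a program may change. -/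
def Prog.wregs : Prog → List ℕ
  | .assign x _ => [x]
  | .seq p q => p.wregs ++ q.wregs
  | .ite _ p q => p.wregs ++ q.wregs
  | .while _ p => p.wregs
  | _ => []

/-- The arrays that a program may change. -/
def Prog.warrs : Prog → List ℕ
  | .put a _ _ => [a]
  | .seq p q => p.warrs ++ q.warrs
  | .ite _ p q => p.warrs ++ q.warrs
  | .while _ p => p.warrs
  | _ => []

theorem Exec.reg_eq {t : ℕ} (h : Exec w p s s' t) : ∀ x ∉ p.wregs, s'.reg x = s.reg x := by
  induction h with
  | skip => intros; rfl
  | assign s x e => intro y hy; simp [Prog.wregs] at hy; simp [hy]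
  | put => intros; rfl
  | seq _ _ ih₁ ih₂ => intro x hx; simp [Prog.wregs] at hx; rw [ih₂ x hx.2, ih₁ x hx.1]
  | ite_true _ _ ih => intro x hx; simp [Prog.wregs] at hx; exact ih x hx.1
  | ite_false _ _ ih => intro x hx; simp [Prog.wregs] at hx; exact ih x hx.2
  | while_true _ _ _ ih₁ ih₂ => intro x hx; rw [ih₂ x hx, ih₁ x hx]
  | while_false => intros; rfl

theorem Exec.arr_eq {t : ℕ} (h : Exec w p s s' t) : ∀ a ∉ p.warrs, s'.arr a = s.arr a := by
  induction h with
  | skip => intros; rfl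
  | assign => intros; rfl
  | put => intro y hy; simp [Prog.warrs] at hy; simp [hy]
  | seq _ _ ih₁ ih₂ => intro x hx; simp [Prog.warrs] at hx; rw [ih₂ x hx.2, ih₁ x hx.1]
  | ite_true _ _ ih => intro x hx; simp [Prog.warrs] at hx; exact ih x hx.1
  | ite_false _ _ ih => intro x hx; simp [Prog.warrs] at hx; exact ih x hx.2
  | while_true _ _ _ ih₁ ih₂ => intro x hx; rw [ih₂ x hx, ih₁ x hx]
  | while_false => intros; rfl

/-- The states `s` and `s'` agree on everything that `p` does not write. -/
def Frame (p : Prog) (s s' : State) : Prop :=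
  (∀ x ∉ p.wregs, s'.reg x = s.reg x) ∧ ∀ a ∉ p.warrs, s'.arr a = s.arr a

/-- What a program does not write stays as it is. -/
theorem WP.frame (h : WP w p s T Q) :
    WP w p s T (fun s' => Q s' ∧ Frame p s s') := by
  obtain ⟨s', t, he, ht, hq⟩ := h
  exact ⟨s', t, he, ht, hq, he.reg_eq, he.arr_eq⟩

theorem WP.loop_frame (I : ℕ → State → Prop) (K : ℕ)
    (h : ∀ r s', Frame p s s' → I r s' → (¬ b.Holds w s' ∧ Q s') ∨
      (b.Holds w s' ∧ WP w p s' K (fun s' => ∃ r' < r, I r' s'))) {r : ℕ} (hI : I r s) :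
    WP w (.while b p) s ((b.cost + K) * r + b.cost) Q := by
  refine WP.loop (fun r s' => Frame p s s' ∧ I r s') K ?_ (r := r) ⟨⟨fun _ _ => rfl, fun _ _ => rfl⟩, hI⟩
  rintro r s' ⟨hf, hI⟩
  rcases h r s' hf hI with h | ⟨hb, h⟩
  · exact Or.inl h
  · refine Or.inr ⟨hb, h.frame.mono le_rfl ?_⟩
    rintro s'' ⟨⟨r', hr', hI'⟩, hr, ha⟩
    exact ⟨r', hr', ⟨fun x hx => (hr x hx).trans (hf.1 x hx),
      fun a hx => (ha a hx).trans (hf.2 a hx)⟩, hI'⟩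

end WordRAM

namespace ViolatingCut

open Classical in
/-- The number of `i < n` with `p i`. -/
noncomputable def cnt (p : ℕ → Prop) (n : ℕ) : ℕ := Nat.count p n

theorem cnt_zero (p : ℕ → Prop) : cnt p 0 = 0 := by simp [cnt]

open Classical in
theorem cnt_succ (p : ℕ → Prop) (n : ℕ) : cnt p (n + 1) = cnt p n + if p n then 1 else 0 := by
  simp [cnt, Nat.count_succ]

theorem cnt_succ_of_pos {p : ℕ → Prop} {n : ℕ} (h : p n) : cnt p (n + 1) = cnt p n + 1 := by
  simp [cnt_succ, h]

theorem cnt_succ_of_neg {p : ℕ → Prop} {n : ℕ} (h : ¬ p n) : cnt p (n + 1) = cnt p n := by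
  simp [cnt_succ, h]

theorem cnt_le_self (p : ℕ → Prop) (n : ℕ) : cnt p n ≤ n := by
  induction n with
  | zero => simp [cnt_zero]
  | succ n ih => rw [cnt_succ]; split_ifs <;> omega

theorem le_cnt_true (n : ℕ) : n ≤ cnt (fun _ => True) n := by
  induction n with
  | zero => simp
  | succ n ih => rw [cnt_succ_of_pos trivial]; omega

theorem cnt_le_of_le (p : ℕ → Prop) {m n : ℕ} (h : m ≤ n) : cnt p m ≤ cnt p n := by
  classical exact Nat.count_monotone p h

theorem cnt_mono {p q : ℕ → Prop} {n : ℕ} (h : ∀ i < n, p i → q i) : cnt p n ≤ cnt q n := by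
  induction n with
  | zero => simp [cnt_zero]
  | succ n ih =>
    have := ih fun i hi => h i (by omega)
    have := h n (by omega)
    rw [cnt_succ, cnt_succ]
    split_ifs <;> first | omega | tauto

theorem cnt_congr {p q : ℕ → Prop} {n : ℕ} (h : ∀ i < n, (p i ↔ q i)) : cnt p n = cnt q n :=
  le_antisymm (cnt_mono fun i hi => (h i hi).1) (cnt_mono fun i hi => (h i hi).2)

theorem cnt_add_le {p q r : ℕ → Prop} {n : ℕ} (h₁ : ∀ i < n, p i → r i) (h₂ : ∀ i < n, q i → r i)
    (h : ∀ i < n, p i → ¬ q i) : cnt p n + cnt q n ≤ cnt r n := by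
  induction n with
  | zero => simp [cnt_zero]
  | succ n ih =>
    have := ih (fun i hi => h₁ i (by omega)) (fun i hi => h₂ i (by omega))
      (fun i hi => h i (by omega))
    have := h n (by omega)
    have := h₁ n (by omega)
    have := h₂ n (by omega)
    rw [cnt_succ, cnt_succ, cnt_succ]
    split_ifs <;> first | omega | tauto

theorem cnt_le_add {p q r : ℕ → Prop} {n : ℕ} (h : ∀ i < n, r i → p i ∨ q i) :
    cnt r n ≤ cnt p n + cnt q n := by
  induction n with
  | zero => simp [cnt_zero]
  | succ n ih =>
    have := ih (fun i hi => h i (by omega))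
    have := h n (by omega)
    rw [cnt_succ, cnt_succ, cnt_succ]
    split_ifs <;> first | omega | tauto

theorem cnt_pos {p : ℕ → Prop} {n i : ℕ} (hi : i < n) (h : p i) : 0 < cnt p n := by
  have h₁ := cnt_le_of_le p (show i + 1 ≤ n from hi)
  rw [cnt_succ_of_pos h] at h₁
  omega

theorem exists_of_cnt_pos {p : ℕ → Prop} {n : ℕ} (h : 0 < cnt p n) : ∃ i < n, p i := by
  by_contra! hc
  have := cnt_mono (q := fun _ => False) (fun i hi hp => hc i hi hp)
  have h0 : ∀ n, cnt (fun _ => False) n = 0 := fun n => by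
    induction n with
    | zero => exact cnt_zero _
    | succ n ih => rw [cnt_succ]; simpa using ih
  rw [h0] at this
  omega

theorem cnt_add (p : ℕ → Prop) (a b : ℕ) : cnt p (a + b) = cnt p a + cnt (fun i => p (a + i)) b := by
  classical
  unfold cnt
  rw [Nat.count_add]

theorem ncard_eq_cnt (p : ℕ → Prop) (n : ℕ) : {i | i < n ∧ p i}.ncard = cnt p n := by
  classical
  unfold cnt
  rw [Nat.count_eq_card_filter_range, ← Set.ncard_coe_finset]
  congr 1
  ext i
  simp

open Classical in
/-- The number of members of the list `l` in `U`. -/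
noncomputable def mult (l : List ℕ) (U : Set ℕ) : ℕ := l.countP (· ∈ U)

theorem mult_le_length (l : List ℕ) (U : Set ℕ) : mult l U ≤ l.length :=
  List.countP_le_length

theorem mult_eq_length {l : List ℕ} {U : Set ℕ} (h : ∀ v ∈ l, v ∈ U) :
    mult l U = l.length := by
  classical
  rw [mult, List.countP_eq_length]
  simpa using h

open Classical in
theorem mult_cons (v : ℕ) (l : List ℕ) (U : Set ℕ) :
    mult (v :: l) U = mult l U + if v ∈ U then 1 else 0 := by
  simp [mult, List.countP_cons]

/-! ### Networks: both orientations of the edges inside `X`, and the ends of the boundary edges -/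

/-- A symmetric digraph with arcs `0, …, M - 1` and a list of `k` terminals. -/
structure Net where
  M : ℕ
  k : ℕ
  tail : ℕ → ℕ
  head : ℕ → ℕ
  rev : ℕ → ℕ
  term : ℕ → ℕ
  rev_lt : ∀ h < M, rev h < M
  tail_rev : ∀ h < M, tail (rev h) = head h
  head_rev : ∀ h < M, head (rev h) = tail h
  rev_rev : ∀ h < M, rev (rev h) = h
  ne : ∀ h < M, tail h ≠ head h

namespace Net

variable (N : Net)

/-- The number of arcs that leave `A`. -/
noncomputable def cut (A : Set ℕ) : ℕ := cnt (fun h => N.tail h ∈ A ∧ N.head h ∉ A) N.M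

/-- The number of terminals in `A`. -/
noncomputable def dem (A : Set ℕ) : ℕ := cnt (fun j => N.term j ∈ A) N.k

/-- `A` is one side of a violating cut. -/
def Viol (c : ℕ) (A : Set ℕ) : Prop := N.cut A < N.dem A ∧ N.cut A < N.dem Aᶜ ∧ N.cut A < c

/-- The union of the sets disjoint from `T` that contain as many sources as arcs leave them. -/
def satur (T : Set ℕ) (l : List ℕ) : Set ℕ :=
  {x | ∃ U : Set ℕ, x ∈ U ∧ Disjoint U T ∧ N.cut U ≤ mult l U}

/-- The head of the `d`-th arc leaving `R`, among the first `n` arcs; `s` if there is none. -/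
noncomputable def pick (R : Set ℕ) (s d : ℕ) : ℕ → ℕ
  | 0 => s
  | n + 1 => by
    classical exact
      if (N.tail n ∈ R ∧ N.head n ∉ R) ∧ cnt (fun h => N.tail h ∈ R ∧ N.head h ∉ R) n + 1 = d
      then N.head n else pick R s d n

open Classical in
/-- The sources after one more round, in which the number `d` is guessed. -/
noncomputable def nextSrcs (T : Set ℕ) (s d : ℕ) (l : List ℕ) : List ℕ :=
  if N.pick (N.satur T l) s d N.M ∈ N.satur T l then l else N.pick (N.satur T l) s d N.M :: l

/-- The sources after some rounds in which the numbers `dg 0, dg 1, …` are guessed. -/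
noncomputable def srcs (T : Set ℕ) (s : ℕ) (dg : ℕ → ℕ) : ℕ → List ℕ
  | 0 => []
  | i + 1 => N.nextSrcs T s (dg i) (srcs T s dg i)

/-- The terminals `st, …, st + W - 1` with a nonzero label. -/
def sinks (st W : ℕ) (lab : ℕ → ℕ) : Set ℕ := {x | ∃ j < W, lab j ≠ 0 ∧ N.term (st + j) = x}

/-- The last of the terminals `st, …, st + W - 1` with label zero. -/
def root (st : ℕ) (lab : ℕ → ℕ) : ℕ → ℕ
  | 0 => 0
  | j + 1 => if lab j = 0 then N.term (st + j) else root st lab j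

theorem cut_compl (A : Set ℕ) : N.cut Aᶜ = N.cut A := by
  have key : ∀ A : Set ℕ, N.cut Aᶜ ≤ N.cut A := by
    intro A
    classical
    unfold cut cnt
    rw [Nat.count_eq_card_filter_range, Nat.count_eq_card_filter_range]
    apply Finset.card_le_card_of_injOn N.rev
    · intro h hh
      simp only [Finset.coe_filter, Finset.mem_range, Set.mem_ofPred_eq, Set.mem_compl_iff,
        not_not] at hh ⊢
      exact ⟨N.rev_lt h hh.1, by rw [N.tail_rev h hh.1, N.head_rev h hh.1]; tauto⟩
    · intro h hh h' hh' e
      simp only [Finset.coe_filter, Finset.mem_range, Set.mem_ofPred_eq] at hh hh'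
      rw [← N.rev_rev h hh.1, e, N.rev_rev h' hh'.1]
  refine le_antisymm (key A) ?_
  simpa using key Aᶜ

theorem dem_mono {A B : Set ℕ} (h : A ⊆ B) : N.dem A ≤ N.dem B := cnt_mono fun _ _ hi => h hi

theorem dem_add_compl (A : Set ℕ) : N.dem A + N.dem Aᶜ = N.k := by
  unfold dem
  refine le_antisymm ?_ ?_
  · refine (cnt_add_le (r := fun _ => True) ?_ ?_ ?_).trans (cnt_le_self _ _) <;> simp
  · refine le_trans ?_ (cnt_le_add (r := fun _ => True) ?_)
    · exact le_cnt_true _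
    · intro i _ _
      exact Classical.em _

theorem Viol.compl {N : Net} {c : ℕ} {A : Set ℕ} (h : N.Viol c A) : N.Viol c Aᶜ := by
  unfold Viol at *
  rw [N.cut_compl, compl_compl]
  tauto

theorem pick_eq_of_le {R : Set ℕ} {s h : ℕ} (hR : N.tail h ∈ R ∧ N.head h ∉ R) {n : ℕ}
    (hn : h < n) :
    N.pick R s (cnt (fun h => N.tail h ∈ R ∧ N.head h ∉ R) h + 1) n = N.head h := by
  induction n with
  | zero => omega
  | succ n ih =>
    rw [pick]
    rcases Nat.lt_succ_iff_lt_or_eq.1 hn with h' | rfl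
    · rw [if_neg, ih h']
      rintro ⟨-, h''⟩
      have := cnt_le_of_le (fun h => N.tail h ∈ R ∧ N.head h ∉ R) (show h + 1 ≤ n from h')
      rw [cnt_succ_of_pos hR] at this
      omega
    · rw [if_pos ⟨hR, rfl⟩]

theorem pick_zero (R : Set ℕ) (s n : ℕ) : N.pick R s 0 n = s := by
  induction n with
  | zero => rfl
  | succ n ih => rw [pick, if_neg (by omega), ih]

/-- In a side of a minimum violating cut, every union of components that misses a terminal of that
side is joined to nothing. -/
theorem cut_eq_zero_of_minimal {c : ℕ} {A : Set ℕ} (hA : N.Viol c A)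
    (hmin : ∀ A', N.Viol c A' → N.cut A ≤ N.cut A') {D : Set ℕ} (hD : D ⊆ A)
    (hs : ∃ j < N.k, N.term j ∈ A ∧ N.term j ∉ D)
    (hDA : ∀ h < N.M, N.tail h ∈ D → N.head h ∉ A \ D) : N.cut D = 0 := by
  by_contra h0
  obtain ⟨h₁, h₂, h₃⟩ := hA
  have hsum : N.cut D + N.cut (A \ D) ≤ N.cut A := by
    refine cnt_add_le ?_ ?_ ?_
    · rintro h hh ⟨ht, hd⟩
      exact ⟨hD ht, fun ha => hDA h hh ht ⟨ha, hd⟩⟩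
    · rintro h hh ⟨ht, hd⟩
      refine ⟨ht.1, fun ha => ?_⟩
      have hd' : N.head h ∈ D := by by_contra hc; exact hd ⟨ha, hc⟩
      refine hDA _ (N.rev_lt h hh) ?_ ?_
      · rwa [N.tail_rev h hh]
      · rwa [N.head_rev h hh]
    · rintro h hh ⟨ht, -⟩ ⟨ht', -⟩
      exact ht'.2 ht
  have hdem : N.dem A ≤ N.dem D + N.dem (A \ D) := by
    refine cnt_le_add ?_
    intro j _ hj
    by_cases hjd : N.term j ∈ D
    · exact Or.inl hjd
    · exact Or.inr ⟨hj, hjd⟩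
  have hDc : N.dem Aᶜ ≤ N.dem Dᶜ := N.dem_mono (Set.compl_subset_compl.2 hD)
  have hDc' : N.dem Aᶜ ≤ N.dem (A \ D)ᶜ := N.dem_mono (Set.compl_subset_compl.2 Set.sdiff_subset)
  have h4 : N.dem (A \ D) ≤ N.cut (A \ D) := by
    by_contra! hc
    have := hmin _ ⟨hc, by omega, by omega⟩
    omega
  have h5 := hmin D ⟨by omega, by omega, by omega⟩
  obtain ⟨j, hj, hjA, hjD⟩ := hs
  have : 0 < N.dem (A \ D) := cnt_pos hj ⟨hjA, hjD⟩
  omega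

/-- Some window of terminals meets both sides of a violating cut. -/
theorem exists_window {c : ℕ} {A : Set ℕ} (hA : N.Viol c A) :
    ∃ st, st + min N.k (2 * c) ≤ N.k ∧ ∃ A', (A' = A ∨ A' = Aᶜ) ∧
      (∃ j < min N.k (2 * c), N.term (st + j) ∈ A') ∧
      N.cut A' < cnt (fun j => N.term (st + j) ∉ A') (min N.k (2 * c)) := by
  have hk := N.dem_add_compl A
  obtain ⟨h₁, h₂, h₃⟩ := hA
  have hW : 2 * N.cut A + 2 ≤ min N.k (2 * c) := by rw [le_min_iff]; omega
  have hWk : min N.k (2 * c) ≤ N.k := min_le_left _ _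
  generalize min N.k (2 * c) = W at hW hWk ⊢
  have hadj : ∃ j, j + 1 < N.k ∧ ¬ (N.term j ∈ A ↔ N.term (j + 1) ∈ A) := by
    by_contra! hc
    have hall : ∀ j < N.k, (N.term j ∈ A ↔ N.term 0 ∈ A) := by
      intro j hj
      induction j with
      | zero => rfl
      | succ j ih => rw [← hc j hj, ih (by omega)]
    obtain ⟨i, hi, hi'⟩ := exists_of_cnt_pos (show 0 < N.dem A by omega)
    obtain ⟨j, hj, hj'⟩ := exists_of_cnt_pos (show 0 < N.dem Aᶜ by omega)
    rw [hall i hi] at hi'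
    rw [Set.mem_compl_iff, hall j hj] at hj'
    exact hj' hi'
  obtain ⟨j, hj, hjA⟩ := hadj
  obtain ⟨st, hst, hstj, hjst⟩ : ∃ st, st + W ≤ N.k ∧ st ≤ j ∧ j + 1 < st + W := by
    rcases le_total j (N.k - W) with h | h
    · exact ⟨j, by omega, by omega, by omega⟩
    · exact ⟨N.k - W, by omega, by omega, by omega⟩
  refine ⟨st, hst, ?_⟩
  have e1 : N.term (st + (j - st)) = N.term j := by congr 1; omega
  have e2 : N.term (st + (j + 1 - st)) = N.term (j + 1) := by congr 1; omega
  have hin : ∃ i < W, N.term (st + i) ∈ A := by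
    by_cases h : N.term j ∈ A
    · exact ⟨j - st, by omega, by rwa [e1]⟩
    · exact ⟨j + 1 - st, by omega, by rw [e2]; tauto⟩
  have hout : ∃ i < W, N.term (st + i) ∈ Aᶜ := by
    by_cases h : N.term j ∈ A
    · exact ⟨j + 1 - st, by omega, by rw [e2]; exact fun h' => hjA ⟨fun _ => h', fun _ => h⟩⟩
    · exact ⟨j - st, by omega, by rwa [e1]⟩
  have hsum : W ≤ cnt (fun i => N.term (st + i) ∉ A) W + cnt (fun i => N.term (st + i) ∉ Aᶜ) W := by
    refine (le_cnt_true W).trans (cnt_le_add fun i _ _ => ?_)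
    simp only [Set.mem_compl_iff, not_not]
    tauto
  by_cases h : N.cut A < cnt (fun i => N.term (st + i) ∉ A) W
  · exact ⟨A, Or.inl rfl, hin, h⟩
  · exact ⟨Aᶜ, Or.inr rfl, hout, by rw [N.cut_compl]; omega⟩

theorem root_spec {st W : ℕ} {lab : ℕ → ℕ} (h : ∃ j < W, lab j = 0) :
    ∃ j < W, lab j = 0 ∧ N.root st lab W = N.term (st + j) := by
  induction W with
  | zero => obtain ⟨j, hj, -⟩ := h; omega
  | succ W ih =>
    rw [root]
    split_ifs with h0
    · exact ⟨W, by omega, h0, rfl⟩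
    · obtain ⟨j, hj, hj0⟩ := h
      have : j ≠ W := by rintro rfl; exact h0 hj0
      obtain ⟨i, hi, h'⟩ := ih ⟨j, by omega, hj0⟩
      exact ⟨i, by omega, h'⟩

theorem satur_disjoint (T : Set ℕ) (l : List ℕ) : Disjoint (N.satur T l) T := by
  rw [Set.disjoint_left]
  rintro x ⟨U, hx, hU, -⟩
  exact Set.disjoint_left.1 hU hx

/-- As long as the set of saturated vertices is not violating, a right guess adds a source in `A`. -/
theorem exists_pick {c : ℕ} {A T : Set ℕ} {s : ℕ} {l : List ℕ} (hA : N.Viol c A)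
    (hmin : ∀ A', N.Viol c A' → N.cut A ≤ N.cut A') (hAT : Disjoint A T)
    (hs : ∃ j < N.k, N.term j = s) (hsA : s ∈ A) (hT : N.cut A < N.dem T)
    (hlA : ∀ v ∈ l, v ∈ A) (hlc : l.length ≤ N.cut A)
    (htight : N.cut (N.satur T l) ≤ mult l (N.satur T l))
    (hR : ¬ N.Viol c (N.satur T l)) :
    l.length < N.cut A ∧ ∃ d ≤ c, N.pick (N.satur T l) s d N.M ∈ A ∧
      N.pick (N.satur T l) s d N.M ∉ N.satur T l := by
  set R := N.satur T l with hRdef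
  have hcutR : N.cut R ≤ N.cut A := htight.trans ((mult_le_length _ _).trans hlc)
  have hRT : Disjoint R T := N.satur_disjoint T l
  have hAR : ¬ A ⊆ R := by
    intro h
    apply hR
    refine ⟨?_, ?_, ?_⟩
    · exact hcutR.trans_lt (hA.1.trans_le (N.dem_mono h))
    · exact hcutR.trans_lt (hT.trans_le (N.dem_mono hRT.symm.subset_compl_right))
    · exact hcutR.trans_lt hA.2.2
  refine ⟨?_, ?_⟩
  · by_contra! hc
    apply hAR
    intro x hx
    refine ⟨A, hx, hAT, ?_⟩
    rw [mult_eq_length hlA]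
    exact hc
  · by_cases hsR : s ∈ R
    · have hD : ∃ h < N.M, N.tail h ∈ A \ R ∧ N.head h ∈ A \ (A \ R) := by
        by_contra! hc
        have h0 : N.cut (A \ R) = 0 := by
          obtain ⟨j, hj, rfl⟩ := hs
          exact N.cut_eq_zero_of_minimal hA hmin Set.sdiff_subset ⟨j, hj, hsA, fun h => h.2 hsR⟩
            (fun h hh ht => hc h hh ht)
        apply hAR
        intro x hx
        by_contra hxR
        exact hxR ⟨A \ R, ⟨hx, hxR⟩, hAT.mono_left Set.sdiff_subset, by omega⟩
      obtain ⟨h, hh, ht, hd⟩ := hD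
      have hdR : N.head h ∈ R := by by_contra hc; exact hd.2 ⟨hd.1, hc⟩
      have hcross : N.tail (N.rev h) ∈ R ∧ N.head (N.rev h) ∉ R := by
        rw [N.tail_rev h hh, N.head_rev h hh]
        exact ⟨hdR, ht.2⟩
      refine ⟨cnt (fun h => N.tail h ∈ R ∧ N.head h ∉ R) (N.rev h) + 1, ?_, ?_⟩
      · rw [← cnt_succ_of_pos (p := fun h => N.tail h ∈ R ∧ N.head h ∉ R) hcross]
        have h1 := cnt_le_of_le (fun h => N.tail h ∈ R ∧ N.head h ∉ R)
          (show N.rev h + 1 ≤ N.M from N.rev_lt h hh)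
        exact h1.trans (hcutR.trans hA.2.2.le)
      · rw [N.pick_eq_of_le hcross (N.rev_lt h hh), N.head_rev h hh]
        exact ht
    · exact ⟨0, by omega, by rw [pick_zero]; exact hsA, by rwa [pick_zero]⟩

/-- If every sequence of guesses fails, then there is no violating cut. -/
theorem not_viol_of_forall_guess (c : ℕ)
    (H : ∀ st lab dg, st + min N.k (2 * c) ≤ N.k → (∀ j, lab j ≤ c) → (∀ i, dg i ≤ c) → ∀ i < c,
      let T := N.sinks st (min N.k (2 * c)) lab
      let l := N.srcs T (N.root st lab (min N.k (2 * c))) dg i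
      N.cut (N.satur T l) ≤ mult l (N.satur T l) ∧ ¬ N.Viol c (N.satur T l)) :
    ∀ A, ¬ N.Viol c A := by
  classical
  intro A₀ hA₀
  obtain ⟨A₁, hA₁, hmin₁⟩ : ∃ A, N.Viol c A ∧ ∀ A', N.Viol c A' → N.cut A ≤ N.cut A' := by
    obtain ⟨A, hA, h⟩ := exists_minimalFor_of_wellFoundedLT (fun A => N.Viol c A) N.cut ⟨A₀, hA₀⟩
    refine ⟨A, hA, fun A' hA' => ?_⟩
    by_contra! hc
    exact absurd (h hA' hc.le) (by omega)
  obtain ⟨st, hst, A, hAA, hin, hout⟩ := N.exists_window hA₁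
  have hA : N.Viol c A := by
    rcases hAA with rfl | rfl
    · exact hA₁
    · exact hA₁.compl
  have hmin : ∀ A', N.Viol c A' → N.cut A ≤ N.cut A' := by
    rcases hAA with rfl | rfl
    · exact hmin₁
    · rwa [N.cut_compl]
  set W := min N.k (2 * c) with hW
  set lab : ℕ → ℕ := fun j => if N.term (st + j) ∈ A then 0 else 1 with hlab
  have hlabc : ∀ j, lab j ≤ c := by
    intro j
    have := hA.2.2
    simp only [hlab]
    split_ifs <;> omega
  set T := N.sinks st W lab with hT
  have hlab0 : ∃ j < W, lab j = 0 := by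
    obtain ⟨j, hj, hjA⟩ := hin
    exact ⟨j, hj, by simp [hlab, hjA]⟩
  obtain ⟨j₀, hj₀, hj₀l, hroot⟩ := N.root_spec (st := st) hlab0
  set s := N.root st lab W
  have hsA : s ∈ A := by
    by_contra hc
    rw [hroot] at hc
    simp [hlab, hc] at hj₀l
  have hAT : Disjoint A T := by
    rw [Set.disjoint_left]
    rintro x hx ⟨j, hj, hl, rfl⟩
    simp [hlab, hx] at hl
  have hTd : N.cut A < N.dem T := by
    refine hout.trans_le ?_
    have h1 := cnt_le_of_le (fun j => N.term j ∈ T) hst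
    rw [cnt_add] at h1
    have h2 : cnt (fun j => N.term (st + j) ∉ A) W ≤ cnt (fun j => N.term (st + j) ∈ T) W :=
      cnt_mono fun j hj hjA => ⟨j, hj, by simp [hlab, hjA], rfl⟩
    unfold dem
    omega
  let good (l : List ℕ) (d : ℕ) : Prop := d ≤ c ∧ N.pick (N.satur T l) s d N.M ∈ A ∧
      N.pick (N.satur T l) s d N.M ∉ N.satur T l
  let strat (l : List ℕ) : ℕ := if h : ∃ d, good l d then h.choose else 0
  have hstratc : ∀ l, strat l ≤ c := by
    intro l
    simp only [strat]
    split_ifs with h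
    · exact h.choose_spec.1
    · omega
  let S (i : ℕ) : List ℕ := Nat.rec [] (fun _ l => N.nextSrcs T s (strat l) l) i
  have hS : ∀ i, N.srcs T s (fun i => strat (S i)) i = S i := by
    intro i
    induction i with
    | zero => rfl
    | succ i ih =>
      rw [srcs, ih]
  have key : ∀ i ≤ N.cut A, (∀ v ∈ S i, v ∈ A) ∧ (S i).length = i := by
    intro i hi
    induction i with
    | zero => simp [S]
    | succ i ih =>
      obtain ⟨ih₁, ih₂⟩ := ih (by omega)
      have hc := hA.2.2
      have := H st lab (fun i => strat (S i)) hst hlabc (fun i => hstratc _) i (by omega)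
      simp only at this
      rw [hS] at this
      obtain ⟨-, d, hd, hdA⟩ := N.exists_pick hA hmin hAT ⟨st + j₀, by omega, hroot.symm⟩ hsA hTd ih₁
        (by omega) this.1 this.2
      have hex : ∃ d, good (S i) d := ⟨d, hd, hdA⟩
      have hsp : good (S i) (strat (S i)) := by
        simp only [strat]
        rw [dif_pos hex]
        exact hex.choose_spec
      have hSi : S (i + 1) = N.pick (N.satur T (S i)) s (strat (S i)) N.M :: S i := by
        exact if_neg hsp.2.2
      rw [hSi]
      refine ⟨?_, by simp [ih₂]⟩
      intro v hv
      rcases List.mem_cons.1 hv with rfl | hv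
      · exact hsp.2.1
      · exact ih₁ v hv
  obtain ⟨h₁, h₂⟩ := key _ le_rfl
  have := H st lab (fun i => strat (S i)) hst hlabc (fun i => hstratc _) (N.cut A) hA.2.2
  simp only at this
  rw [hS] at this
  obtain ⟨h, -⟩ := N.exists_pick hA hmin hAT ⟨st + j₀, by omega, hroot.symm⟩ hsA hTd h₁
    (by omega) this.1 this.2
  omega

theorem sinks_congr (st : ℕ) {W : ℕ} {lab lab' : ℕ → ℕ} (h : ∀ j < W, lab j = lab' j) :
    N.sinks st W lab = N.sinks st W lab' := by
  ext x
  constructor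
  · rintro ⟨j, hj, hl, rfl⟩
    exact ⟨j, hj, by rwa [← h j hj], rfl⟩
  · rintro ⟨j, hj, hl, rfl⟩
    exact ⟨j, hj, by rwa [h j hj], rfl⟩

theorem root_congr (st : ℕ) {W : ℕ} {lab lab' : ℕ → ℕ} (h : ∀ j < W, lab j = lab' j) :
    N.root st lab W = N.root st lab' W := by
  induction W with
  | zero => rfl
  | succ W ih => rw [root, root, h W (by omega), ih fun j hj => h j (by omega)]

theorem srcs_congr (T : Set ℕ) (s : ℕ) {dg dg' : ℕ → ℕ} {i : ℕ} (h : ∀ j < i, dg j = dg' j) :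
    N.srcs T s dg i = N.srcs T s dg' i := by
  induction i with
  | zero => rfl
  | succ i ih => rw [srcs, srcs, h i (by omega), ih fun j hj => h j (by omega)]

/-- The guess `g` fails in round `i`: no violating cut is found. -/
def Fails (c st g i : ℕ) : Prop :=
  let T := N.sinks st (min N.k (2 * c)) (fun j => g / (c + 1) ^ j % (c + 1))
  let l := N.srcs T (N.root st (fun j => g / (c + 1) ^ j % (c + 1)) (min N.k (2 * c)))
    (fun i => g / (c + 1) ^ (min N.k (2 * c) + i) % (c + 1)) i
  N.cut (N.satur T l) ≤ mult l (N.satur T l) ∧ ¬ N.Viol c (N.satur T l)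

theorem exists_digits {b : ℕ} (L : ℕ) {d : ℕ → ℕ} (hd : ∀ j, d j < b) :
    ∃ g < b ^ L, ∀ j < L, g / b ^ j % b = d j := by
  induction L generalizing d with
  | zero => exact ⟨0, by simp, by omega⟩
  | succ L ih =>
    obtain ⟨g, hg, h⟩ := ih (d := fun j => d (j + 1)) fun j => hd _
    have hb : 0 < b := (Nat.zero_le _).trans_lt (hd 0)
    refine ⟨d 0 + b * g, ?_, fun j hj => ?_⟩
    · have h1 : b * (g + 1) ≤ b * b ^ L := Nat.mul_le_mul_left _ hg
      have := hd 0
      rw [pow_succ']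
      rw [mul_add] at h1
      omega
    · cases j with
      | zero => rw [pow_zero, Nat.div_one, Nat.add_mul_mod_self_left, Nat.mod_eq_of_lt (hd 0)]
      | succ j =>
        rw [pow_succ', ← Nat.div_div_eq_div_mul, Nat.add_mul_div_left _ _ hb,
          Nat.div_eq_of_lt (hd 0), zero_add]
        exact h j (by omega)

theorem not_viol_of_fails {c : ℕ} (H : ∀ st, st + min N.k (2 * c) ≤ N.k →
      ∀ g < (c + 1) ^ (min N.k (2 * c) + c), ∀ i < c, N.Fails c st g i) (A : Set ℕ) :
    ¬ N.Viol c A := by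
  refine N.not_viol_of_forall_guess c ?_ A
  intro st lab dg hst hlab hdg i hi
  unfold Fails at H
  generalize min N.k (2 * c) = W at H hst ⊢
  obtain ⟨g, hg, h⟩ := exists_digits (b := c + 1) (W + c)
    (d := fun j => if j < W then lab j else dg (j - W)) (fun j => by
      have := hlab j
      have := hdg (j - W)
      split_ifs <;> omega)
  have h1 : ∀ j < W, g / (c + 1) ^ j % (c + 1) = lab j := fun j hj => by
    rw [h j (by omega), if_pos hj]
  have h2 : ∀ j < i, g / (c + 1) ^ (W + j) % (c + 1) = dg j := fun j hj => by
    rw [h (W + j) (by omega), if_neg (by omega)]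
    congr 1
    omega
  have := H st hst g hg i hi
  rw [N.sinks_congr st h1, N.root_congr st h1] at this
  dsimp only at this
  rwa [N.srcs_congr _ _ h2] at this

end Net

end ViolatingCut

namespace ViolatingCut

namespace Net

variable (N : Net)

/-! ### Flows -/

open Classical in
/-- The indicator of `U`. -/
noncomputable def ind (U : Set ℕ) (x : ℕ) : ℤ := if x ∈ U then 1 else 0

/-- The net flow out of `U`. -/
noncomputable def net (f : ℕ → ℕ) (U : Set ℕ) : ℤ :=
  ∑ h ∈ Finset.range N.M, (f h : ℤ) * (ind U (N.tail h) - ind U (N.head h))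

/-- The flow `f` uses every edge at most once. -/
structure IsPreflow (f : ℕ → ℕ) : Prop where
  le_one : ∀ h < N.M, f h ≤ 1
  anti : ∀ h < N.M, f h = 1 → f (N.rev h) = 0

/-- `f` is a flow from the sources `l` to `T`. -/
structure IsFlow (T : Set ℕ) (l : List ℕ) (f : ℕ → ℕ) : Prop extends N.IsPreflow f where
  net_eq : ∀ U, Disjoint U T → N.net f U = mult l U

open Classical in
theorem cut_eq_sum (U : Set ℕ) : (N.cut U : ℤ) =
    ∑ h ∈ Finset.range N.M, if N.tail h ∈ U ∧ N.head h ∉ U then (1 : ℤ) else 0 := by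
  unfold cut
  generalize N.M = n
  induction n with
  | zero => simp [cnt_zero]
  | succ n ih =>
    rw [Finset.sum_range_succ, ← ih, cnt_succ]
    split_ifs <;> simp

theorem eq_one_of_cut_le_net {f : ℕ → ℕ} (hf : ∀ h < N.M, f h ≤ 1) {U : Set ℕ}
    (hU : (N.cut U : ℤ) ≤ N.net f U) {h : ℕ} (hh : h < N.M) (ht : N.tail h ∈ U)
    (hd : N.head h ∉ U) : f h = 1 := by
  classical
  have hle : ∀ h ∈ Finset.range N.M, (f h : ℤ) * (ind U (N.tail h) - ind U (N.head h)) ≤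
      if N.tail h ∈ U ∧ N.head h ∉ U then (1 : ℤ) else 0 := by
    intro h hh
    have h1 : (f h : ℤ) ≤ 1 := by exact_mod_cast hf h (Finset.mem_range.1 hh)
    unfold ind
    by_cases h2 : N.tail h ∈ U <;> by_cases h3 : N.head h ∈ U <;> simp [h2, h3, h1]
  rw [cut_eq_sum] at hU
  have := (Finset.sum_eq_sum_iff_of_le hle).1 (le_antisymm (Finset.sum_le_sum hle) hU) h
    (Finset.mem_range.2 hh)
  simpa [ind, ht, hd] using this

theorem cut_eq_net {f : ℕ → ℕ} (hf : N.IsPreflow f) {U : Set ℕ}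
    (hU : ∀ h < N.M, N.tail h ∈ U → N.head h ∉ U → f h = 1) : (N.cut U : ℤ) = N.net f U := by
  classical
  rw [cut_eq_sum]
  refine Finset.sum_congr rfl fun h hh => ?_
  rw [Finset.mem_range] at hh
  unfold ind
  by_cases h2 : N.tail h ∈ U <;> by_cases h3 : N.head h ∈ U
  · simp [h2, h3]
  · simp [h2, h3, hU h hh h2 h3]
  · have h4 := hU (N.rev h) (N.rev_lt h hh) (by rwa [N.tail_rev h hh]) (by rwa [N.head_rev h hh])
    have h5 := hf.anti _ (N.rev_lt h hh) h4
    rw [N.rev_rev h hh] at h5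
    simp [h2, h3, h5]
  · simp [h2, h3]

/-- What cannot reach the sinks in the residual network is the set of saturated vertices. -/
theorem satur_eq {T V : Set ℕ} {l : List ℕ} {f : ℕ → ℕ} (hf : N.IsFlow T l f) (hT : T ⊆ V)
    (hV : ∀ h < N.M, N.head h ∈ V → N.tail h ∉ V → f h = 1)
    (hreach : ∀ U, Disjoint U T → (∀ h < N.M, N.tail h ∈ U → N.head h ∉ U → f h = 1) →
      Disjoint U V) :
    N.satur T l = Vᶜ ∧ N.cut (N.satur T l) ≤ mult l (N.satur T l) := by
  have hd : Disjoint Vᶜ T := by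
    rw [Set.disjoint_left]
    exact fun x hx hxT => hx (hT hxT)
  have hcut : N.cut Vᶜ ≤ mult l Vᶜ := by
    have h1 := N.cut_eq_net hf.toIsPreflow (U := Vᶜ)
      (fun h hh ht hd => hV h hh (by simpa using hd) ht)
    rw [hf.net_eq _ hd] at h1
    exact_mod_cast h1.le
  have heq : N.satur T l = Vᶜ := by
    ext x
    constructor
    · rintro ⟨U, hx, hU, hl⟩
      refine Set.disjoint_left.1 (hreach U hU fun h hh ht hd => ?_) hx
      refine N.eq_one_of_cut_le_net hf.le_one ?_ hh ht hd
      rw [hf.net_eq U hU]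
      exact_mod_cast hl
    · intro hx
      exact ⟨Vᶜ, hx, hd, hcut⟩
  exact ⟨heq, by rw [heq]; exact hcut⟩

/-- The flow after one more unit is sent along the arc `h`. -/
def send (f : ℕ → ℕ) (h : ℕ) : ℕ → ℕ :=
  if f (N.rev h) = 1 then Function.update f (N.rev h) 0 else Function.update f h 1

theorem net_update (f : ℕ → ℕ) {h : ℕ} (hh : h < N.M) (a : ℕ) (U : Set ℕ) :
    N.net (Function.update f h a) U =
      N.net f U + ((a : ℤ) - f h) * (ind U (N.tail h) - ind U (N.head h)) := by
  unfold net
  rw [← Finset.add_sum_erase _ _ (Finset.mem_range.2 hh),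
    ← Finset.add_sum_erase (a := h) _ _ (Finset.mem_range.2 hh)]
  have : ∀ g ∈ (Finset.range N.M).erase h,
      ((Function.update f h a g : ℕ) : ℤ) * (ind U (N.tail g) - ind U (N.head g)) =
        (f g : ℤ) * (ind U (N.tail g) - ind U (N.head g)) := by
    intro g hg
    rw [Function.update_of_ne (Finset.ne_of_mem_erase hg)]
  rw [Finset.sum_congr rfl this, Function.update_self]
  ring

theorem net_send {f : ℕ → ℕ} {h : ℕ} (hh : h < N.M) (h0 : f h = 0) (U : Set ℕ) :
    N.net (N.send f h) U = N.net f U + ind U (N.tail h) - ind U (N.head h) := by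
  unfold send
  split_ifs with h1
  · rw [net_update _ _ (N.rev_lt h hh), N.tail_rev h hh, N.head_rev h hh, h1]
    push_cast
    ring
  · rw [net_update _ _ hh, h0]
    push_cast
    ring

theorem IsPreflow.send {N : Net} {f : ℕ → ℕ} (hf : N.IsPreflow f) {h : ℕ} (hh : h < N.M) :
    N.IsPreflow (N.send f h) := by
  unfold Net.send
  split_ifs with h1
  · refine ⟨fun g hg => ?_, fun g hg => ?_⟩
    · rw [Function.update_apply]
      have := hf.le_one g hg
      split_ifs <;> omega
    · rw [Function.update_apply, Function.update_apply]
      have := hf.anti g hg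
      split_ifs <;> simp_all
  · have hrev : f (N.rev h) = 0 := by
      have := hf.le_one _ (N.rev_lt h hh)
      omega
    refine ⟨fun g hg => ?_, fun g hg => ?_⟩
    · rw [Function.update_apply]
      have := hf.le_one g hg
      split_ifs <;> omega
    · rw [Function.update_apply, Function.update_apply]
      have h3 := hf.anti g hg
      by_cases hgh : g = h
      · subst hgh
        have : N.rev g ≠ g := by
          intro e
          have := N.tail_rev g hg
          rw [e] at this
          exact N.ne g hg this
        simp [this, hrev]
      · by_cases hr : N.rev g = h
        · subst hr
          rw [N.rev_rev g hg] at hrev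
          simp [hgh, hrev]
        · simpa [hgh, hr] using h3

theorem send_eq_zero {f : ℕ → ℕ} {h g : ℕ} (hg : f g = 0) (hgh : g ≠ h) : N.send f h g = 0 := by
  unfold send
  split_ifs
  · rw [Function.update_apply]
    split_ifs
    · rfl
    · exact hg
  · rw [Function.update_of_ne hgh, hg]

/-! ### Search trees -/

/-- `q 0, …, q (qt - 1)` are distinct, and they are the elements marked by `vis`. -/
structure _root_.ViolatingCut.IsQueue (vis q : ℕ → ℕ) (qt : ℕ) : Prop where
  inj : ∀ i < qt, ∀ j < qt, q i = q j → i = j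
  vis_iff : ∀ x, vis x ≠ 0 ↔ ∃ i < qt, q i = x
  vis_le : ∀ x, vis x ≤ 1

theorem _root_.ViolatingCut.IsQueue.push {vis q : ℕ → ℕ} {qt u : ℕ} (h : IsQueue vis q qt)
    (hu : vis u = 0) :
    IsQueue (Function.update vis u 1) (Function.update q qt u) (qt + 1) := by
  have hne : ∀ i < qt, q i ≠ u := fun i hi e => (h.vis_iff u).2 ⟨i, hi, e⟩ hu
  refine ⟨fun i hi j hj e => ?_, fun x => ?_, fun x => ?_⟩
  rotate_left 2
  · have := h.vis_le x
    rw [Function.update_apply]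
    split_ifs <;> omega
  · rw [Function.update_apply, Function.update_apply] at e
    split_ifs at e with h1 h2 h2
    · omega
    · exact absurd e.symm (hne j (by omega))
    · exact absurd e (hne i (by omega))
    · exact h.inj i (by omega) j (by omega) e
  · constructor
    · intro hx
      by_cases hxu : x = u
      · exact ⟨qt, by omega, by simp [hxu]⟩
      · rw [Function.update_of_ne hxu] at hx
        obtain ⟨i, hi, e⟩ := (h.vis_iff x).1 hx
        exact ⟨i, by omega, by rwa [Function.update_of_ne (by omega)]⟩
    · rintro ⟨i, hi, e⟩
      by_cases hxu : x = u
      · simp [hxu]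
      · rw [Function.update_of_ne hxu]
        refine (h.vis_iff x).2 ⟨i, ?_, ?_⟩
        · by_contra hc
          have : i = qt := by omega
          subst this
          simp at e
          exact hxu e.symm
        · rwa [Function.update_of_ne] at e
          rintro rfl
          simp at e
          exact hxu e.symm

/-- `q 0, …, q (qt - 1)` are distinct vertices, marked by `vis`, and `par` points from each of
them along an arc that carries no flow to an earlier one, or is `0` and the vertex is a sink. -/
structure IsTree (T : Set ℕ) (f vis par q : ℕ → ℕ) (qt : ℕ) : Prop
    extends IsQueue vis q qt where
  par_eq_zero : ∀ x, vis x = 0 → par x = 0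
  sub : ∀ x ∈ T, vis x ≠ 0
  par_spec : ∀ i < qt, (par (q i) = 0 ∧ q i ∈ T) ∨
    ∃ h < N.M, par (q i) = h + 1 ∧ N.tail h = q i ∧ f h = 0 ∧ ∃ j < i, N.head h = q j

theorem IsTree.disjoint {N : Net} {T : Set ℕ} {f vis par q : ℕ → ℕ} {qt : ℕ}
    (ht : N.IsTree T f vis par q qt) {U : Set ℕ} (hU : Disjoint U T)
    (hf : ∀ h < N.M, N.tail h ∈ U → N.head h ∉ U → f h = 1) : Disjoint U {x | vis x ≠ 0} := by
  have key : ∀ i < qt, q i ∉ U := by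
    intro i
    induction i using Nat.strong_induction_on with
    | _ i ih =>
      intro hi hiU
      rcases ht.par_spec i hi with ⟨-, hT⟩ | ⟨h, hh, -, htail, h0, j, hj, hhead⟩
      · exact Set.disjoint_left.1 hU hiU hT
      · have := hf h hh (by rwa [htail]) (by rw [hhead]; exact ih j hj (by omega))
        omega
  rw [Set.disjoint_left]
  intro x hx hv
  obtain ⟨i, hi, rfl⟩ := (ht.vis_iff x).1 hv
  exact key i hi hx

/-- The last of the arcs `0, …, n - 1` with head `v`, plus one; `0` if there is none. -/
def last (head : ℕ → ℕ) (v : ℕ) : ℕ → ℕ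
  | 0 => 0
  | n + 1 => if head n = v then n + 1 else last head v n

theorem last_congr {head head' : ℕ → ℕ} {v n : ℕ} (h : ∀ i < n, head i = head' i) :
    last head v n = last head' v n := by
  induction n with
  | zero => rfl
  | succ n ih => rw [last, last, h n (by omega), ih fun i hi => h i (by omega)]

theorem last_le (head : ℕ → ℕ) (v n : ℕ) : last head v n ≤ n := by
  induction n with
  | zero => rfl
  | succ n ih => rw [last]; split_ifs <;> omega

theorem last_spec {head : ℕ → ℕ} {v n i : ℕ} (hi : i < n) (h : head i = v) :
    i < last head v n := by
  induction n with
  | zero => omega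
  | succ n ih =>
    rw [last]
    split_ifs with h'
    · exact hi
    · refine ih ?_
      have : i ≠ n := by rintro rfl; exact h' h
      omega

theorem head_of_last {head : ℕ → ℕ} {v n : ℕ} (h : last head v n ≠ 0) :
    head (last head v n - 1) = v := by
  induction n with
  | zero => exact absurd rfl h
  | succ n ih =>
    rw [last] at h ⊢
    split_ifs with h'
    · exact h'
    · rw [if_neg h'] at h
      exact ih h

theorem IsTree.push {N : Net} {T : Set ℕ} {f vis par q : ℕ → ℕ} {qt : ℕ}
    (ht : N.IsTree T f vis par q qt) {h j : ℕ} (hh : h < N.M) (h0 : f h = 0)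
    (hv : vis (N.tail h) = 0) (hj : j < qt) (hhead : N.head h = q j) :
    N.IsTree T f (Function.update vis (N.tail h) 1) (Function.update par (N.tail h) (h + 1))
      (Function.update q qt (N.tail h)) (qt + 1) := by
  have hne : ∀ i < qt, q i ≠ N.tail h := fun i hi e => (ht.vis_iff _).2 ⟨i, hi, e⟩ hv
  refine ⟨ht.toIsQueue.push hv, fun x hx => ?_, fun x hx => ?_, fun i hi => ?_⟩
  · have hxu : x ≠ N.tail h := by rintro rfl; simp at hx
    rw [Function.update_of_ne hxu] at hx ⊢
    exact ht.par_eq_zero x hx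
  · have := ht.sub x hx
    rw [Function.update_apply]
    split_ifs <;> simp [this]
  · rcases Nat.lt_succ_iff_lt_or_eq.1 hi with hi' | rfl
    · rw [Function.update_of_ne (show i ≠ qt by omega), Function.update_of_ne (hne i hi')]
      rcases ht.par_spec i hi' with h1 | ⟨g, hg, h1, h2, h3, j, hj, h4⟩
      · exact Or.inl h1
      · exact Or.inr ⟨g, hg, h1, h2, h3, j, hj, by rwa [Function.update_of_ne (by omega)]⟩
    · refine Or.inr ⟨h, hh, ?_, ?_, h0, j, hj, ?_⟩
      · simp
      · simp
      · rwa [Function.update_of_ne (by omega)]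

/-- The state of a search in which the arcs into `q 0, …, q (qh - 1)` are processed, except for
those into `q (qh - 1)` on the list that starts with `cur`. -/
structure IsScan (T : Set ℕ) (f vis par q : ℕ → ℕ) (qt qh cur : ℕ) : Prop
    extends N.IsTree T f vis par q qt where
  le : qh ≤ qt
  cur_spec : cur ≠ 0 → 0 < qh ∧ cur ≤ N.M ∧ N.head (cur - 1) = q (qh - 1)
  closed : ∀ h < N.M, ∀ i < qh, N.head h = q i → (i + 1 < qh ∨ cur ≤ h) →
    vis (N.tail h) ≠ 0 ∨ f h ≠ 0

/-- The arcs `D` were processed by a search. -/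
def IsDone (q : ℕ → ℕ) (qh cur : ℕ) (D : Finset ℕ) : Prop :=
  ∀ h ∈ D, h < N.M ∧ ∃ i < qh, N.head h = q i ∧ (i + 1 = qh → cur ≤ h)

section

variable {N} {T : Set ℕ} {f vis par q : ℕ → ℕ} {qt qh cur : ℕ} {D : Finset ℕ}

theorem IsScan.advance (hs : N.IsScan T f vis par q qt qh 0) (hq : qh < qt) :
    N.IsScan T f vis par q qt (qh + 1) (last N.head (q qh) N.M) := by
  refine ⟨hs.toIsTree, hq, fun h => ⟨by omega, last_le _ _ _, head_of_last h⟩, ?_⟩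
  intro h hh i hi hhead hi'
  rcases Nat.lt_succ_iff_lt_or_eq.1 hi with hi'' | rfl
  · exact hs.closed h hh i hi'' hhead (Or.inr (by omega))
  · have := last_spec hh hhead
    omega

theorem IsDone.advance (hD : N.IsDone q qh cur D) (cur' : ℕ) : N.IsDone q (qh + 1) cur' D := by
  intro h hh
  obtain ⟨h1, i, hi, h2, -⟩ := hD h hh
  exact ⟨h1, i, by omega, h2, by omega⟩

theorem IsScan.notMem (hs : N.IsScan T f vis par q qt qh cur) (hD : N.IsDone q qh cur D)
    (hc : cur ≠ 0) : cur - 1 ∉ D := by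
  intro h
  obtain ⟨h1, i, hi, h2, h3⟩ := hD _ h
  obtain ⟨h4, h5, h6⟩ := hs.cur_spec hc
  have hle := hs.le
  have := hs.inj i (by omega) (qh - 1) (by omega) (by rw [← h2, h6])
  have := h3 (by omega)
  omega

theorem IsScan.next (hs : N.IsScan T f vis par q qt qh cur) (hc : cur ≠ 0)
    (hv : vis (N.tail (cur - 1)) ≠ 0 ∨ f (cur - 1) ≠ 0) :
    N.IsScan T f vis par q qt qh (last N.head (N.head (cur - 1)) (cur - 1)) := by
  obtain ⟨h4, h5, h6⟩ := hs.cur_spec hc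
  refine ⟨hs.toIsTree, hs.le, fun h => ⟨h4, ?_, ?_⟩, ?_⟩
  · have := last_le N.head (N.head (cur - 1)) (cur - 1)
    omega
  · rw [head_of_last h, h6]
  · intro h hh i hi hhead hi'
    by_cases hlt : i + 1 < qh
    · exact hs.closed h hh i hi hhead (Or.inl hlt)
    · have hi'' : i = qh - 1 := by omega
      rcases lt_trichotomy h (cur - 1) with h7 | rfl | h7
      · have := last_spec h7 (show N.head h = N.head (cur - 1) by rw [hhead, h6, hi''])
        omega
      · exact hv
      · exact hs.closed h hh i hi hhead (Or.inr (by omega))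

theorem IsScan.push (hs : N.IsScan T f vis par q qt qh cur) (hc : cur ≠ 0)
    (hv : vis (N.tail (cur - 1)) = 0) (h0 : f (cur - 1) = 0) :
    N.IsScan T f (Function.update vis (N.tail (cur - 1)) 1)
      (Function.update par (N.tail (cur - 1)) (cur - 1 + 1))
      (Function.update q qt (N.tail (cur - 1))) (qt + 1) qh cur := by
  obtain ⟨h4, h5, h6⟩ := hs.cur_spec hc
  have hle := hs.le
  refine ⟨hs.toIsTree.push (by omega) h0 hv (show qh - 1 < qt by omega) h6, by omega,
    fun _ => ⟨h4, h5, ?_⟩, ?_⟩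
  · rw [Function.update_of_ne (by omega), h6]
  · intro h hh i hi hhead hi'
    rw [Function.update_of_ne (by omega)] at hhead
    rcases hs.closed h hh i hi hhead hi' with h7 | h7
    · left
      rw [Function.update_apply]
      split_ifs <;> simp [h7]
    · exact Or.inr h7

theorem IsDone.congr (hD : N.IsDone q qh cur D) {q' : ℕ → ℕ} (hq : ∀ i < qh, q i = q' i) :
    N.IsDone q' qh cur D := by
  intro h hh
  obtain ⟨h1, i, hi, h2, h3⟩ := hD h hh
  exact ⟨h1, i, hi, by rw [h2, hq i hi], h3⟩

theorem IsScan.isDone_insert (hs : N.IsScan T f vis par q qt qh cur) (hD : N.IsDone q qh cur D)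
    (hc : cur ≠ 0) :
    N.IsDone q qh (last N.head (N.head (cur - 1)) (cur - 1)) (insert (cur - 1) D) := by
  obtain ⟨h4, h5, h6⟩ := hs.cur_spec hc
  have hl := last_le N.head (N.head (cur - 1)) (cur - 1)
  intro h hh
  rcases Finset.mem_insert.1 hh with rfl | hh
  · exact ⟨by omega, qh - 1, by omega, h6, fun _ => hl⟩
  · obtain ⟨h1, i, hi, h2, h3⟩ := hD h hh
    exact ⟨h1, i, hi, h2, fun h => by have := h3 h; omega⟩

theorem IsDone.card_le (hD : N.IsDone q qh cur D) : D.card ≤ N.M := by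
  have : D ⊆ Finset.range N.M := fun h hh => Finset.mem_range.2 (hD h hh).1
  simpa using Finset.card_le_card this

end

end Net

end ViolatingCut

namespace ViolatingCut

open WordRAM Prog Expr Test

/-! ### The program

Registers: `2` is `c`, `3` the number `M` of arcs, `4` the number `k` of terminals, `5` the size of
a window, `6` is `c + 1`, `7` the start of the window, `8` the guess, `10` the part of the guess
that is still to be decoded, `11` a decoded digit, `13` the root, `14` the number of rounds left,
`15` the answer, `17` the size of the queue. Arrays: `3` marks visited vertices, `4`, `5`, `6` hold
tails, heads and reversals of arcs, `7` and `8` the lists of arcs by head, `9` the terminals, `10` the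
flow, `11` the queue, `12` the parent arcs, `13` the labels. -/

/-- `reg 11 := reg 10 % reg 6`, `reg 10 := reg 10 / reg 6`. -/
def choose : Prog :=
  assign 12 (lit 0) ;;
  .while (.eq (sub (var 6) (var 10)) (lit 0))
    (assign 10 (sub (var 10) (var 6)) ;; assign 12 (add (var 12) (lit 1))) ;;
  assign 11 (var 10) ;; assign 10 (var 12)

/-- Unmark everything in the queue and empty it. -/
def reset : Prog :=
  .while (.lt (lit 0) (var 17))
    (assign 17 (sub (var 17) (lit 1)) ;; put 3 (get 11 (var 17)) (lit 0) ;;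
      put 12 (get 11 (var 17)) (lit 0))

/-- Mark the sinks and put them into the queue. -/
def pushSinks : Prog :=
  assign 19 (lit 0) ;;
  .while (.lt (var 19) (var 5))
    (.ite (.lt (lit 0) (get 13 (var 19)))
      (assign 20 (get 9 (add (var 7) (var 19))) ;;
        .ite (.eq (get 3 (var 20)) (lit 0))
          (put 3 (var 20) (lit 1) ;; put 11 (var 17) (var 20) ;;
            assign 17 (add (var 17) (lit 1)))
          .skip)
      .skip ;;
    assign 19 (add (var 19) (lit 1)))

/-- Mark everything from which the queue can be reached in the residual network. -/
def explore : Prog :=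
  assign 16 (lit 0) ;; assign 18 (lit 0) ;;
  .while (.lt (var 16) (add (var 17) (var 18)))
    (.ite (.eq (var 18) (lit 0))
      (assign 18 (get 7 (get 11 (var 16))) ;; assign 16 (add (var 16) (lit 1)))
      (assign 19 (sub (var 18) (lit 1)) ;; assign 18 (get 8 (var 19)) ;;
        .ite (.eq (get 10 (var 19)) (lit 0))
          (assign 20 (get 4 (var 19)) ;;
            .ite (.eq (get 3 (var 20)) (lit 0))
              (put 3 (var 20) (lit 1) ;; put 12 (var 20) (add (var 19) (lit 1)) ;;
                put 11 (var 17) (var 20) ;; assign 17 (add (var 17) (lit 1)))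
              .skip)
          .skip))

/-- Count the arcs from unmarked to marked vertices (`reg 21`) and pick the head of the one with
number `reg 11` (`reg 20`). -/
def scanArcs : Prog :=
  assign 19 (lit 0) ;; assign 21 (lit 0) ;; assign 20 (var 13) ;;
  .while (.lt (var 19) (var 3))
    (.ite (.eq (get 3 (get 4 (var 19))) (lit 0))
      (.ite (.lt (lit 0) (get 3 (get 5 (var 19))))
        (assign 21 (add (var 21) (lit 1)) ;;
          .ite (.eq (var 21) (var 11)) (assign 20 (get 5 (var 19))) .skip)
        .skip)
      .skip ;;
    assign 19 (add (var 19) (lit 1)))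

/-- Count the unmarked (`reg 22`) and the marked (`reg 23`) terminals. -/
def scanTerms : Prog :=
  assign 19 (lit 0) ;; assign 22 (lit 0) ;; assign 23 (lit 0) ;;
  .while (.lt (var 19) (var 4))
    (.ite (.eq (get 3 (get 9 (var 19))) (lit 0))
      (assign 22 (add (var 22) (lit 1))) (assign 23 (add (var 23) (lit 1))) ;;
    assign 19 (add (var 19) (lit 1)))

/-- Send a unit of flow from `reg 20` along the parent arcs. -/
def augment : Prog :=
  .while (.lt (lit 0) (get 12 (var 20)))
    (assign 19 (sub (get 12 (var 20)) (lit 1)) ;;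
      .ite (.eq (get 10 (get 6 (var 19))) (lit 1)) (put 10 (get 6 (var 19)) (lit 0))
        (put 10 (var 19) (lit 1)) ;;
      assign 20 (get 5 (var 19)))

/-- Mark the vertices that can reach the sinks. -/
def search : Prog := reset ;; pushSinks ;; explore

/-- Set `reg 15` if the marked vertices are a side of a violating cut. -/
def verdict : Prog :=
  .ite (.lt (var 21) (var 22))
    (.ite (.lt (var 21) (var 23)) (.ite (.lt (var 21) (var 2)) (assign 15 (lit 1)) .skip) .skip)
    .skip

/-- One round: search, guess, test, augment. -/
def round : Prog :=
  search ;; choose ;; scanArcs ;; scanTerms ;; verdict ;;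
  .ite (.eq (var 15) (lit 1)) (assign 14 (lit 0))
    (augment ;; assign 14 (sub (var 14) (lit 1)))

/-- Set the flow to zero. -/
def clearFlow : Prog :=
  assign 19 (lit 0) ;;
  .while (.lt (var 19) (var 3)) (put 10 (var 19) (lit 0) ;; assign 19 (add (var 19) (lit 1)))

/-- Guess the labels of the terminals in the window. -/
def labels : Prog :=
  assign 13 (lit 0) ;; assign 19 (lit 0) ;;
  .while (.lt (var 19) (var 5))
    (choose ;; put 13 (var 19) (var 11) ;;
      .ite (.eq (var 11) (lit 0)) (assign 13 (get 9 (add (var 7) (var 19)))) .skip ;;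
      assign 19 (add (var 19) (lit 1)))

/-- Try one guess. -/
def attempt : Prog :=
  clearFlow ;; assign 10 (var 8) ;; labels ;;
  assign 14 (var 2) ;; .while (.lt (lit 0) (var 14)) round

/-- Try all guesses for one window. -/
def guesses : Prog :=
  assign 8 (lit 0) ;; assign 9 (lit 1) ;;
  .while (.lt (lit 0) (var 9))
    (attempt ;;
      .ite (.eq (var 15) (lit 1)) (assign 9 (lit 0))
        (.ite (.eq (var 10) (lit 0)) (assign 8 (add (var 8) (lit 1))) (assign 9 (lit 0))))

/-- Try all windows. -/
def windows : Prog :=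
  .ite (.lt (var 4) (add (var 2) (var 2))) (assign 5 (var 4)) (assign 5 (add (var 2) (var 2))) ;;
  assign 6 (add (var 2) (lit 1)) ;;
  assign 7 (add (sub (var 4) (var 5)) (lit 1)) ;;
  .while (.lt (lit 0) (var 7))
    (assign 7 (sub (var 7) (lit 1)) ;; guesses ;;
      .ite (.eq (var 15) (lit 1)) (assign 7 (lit 0)) .skip)

/-- Append an arc from `reg 20` to `reg 21` whose reversal is `r`. -/
def addArc (r : Expr) : Prog :=
  put 4 (var 3) (var 20) ;; put 5 (var 3) (var 21) ;; put 6 (var 3) r ;;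
  put 8 (var 3) (get 7 (var 21)) ;; put 7 (var 21) (add (var 3) (lit 1)) ;;
  assign 3 (add (var 3) (lit 1))

/-- Build the network. -/
def prepare : Prog :=
  .while (.lt (var 19) (var 1))
    (assign 20 (get 0 (var 19)) ;; assign 21 (get 1 (var 19)) ;;
      .ite (.eq (get 2 (var 20)) (lit 1))
        (.ite (.eq (get 2 (var 21)) (lit 1))
          (.ite (.eq (var 20) (var 21)) .skip
            (addArc (add (var 3) (lit 1)) ;;
              assign 20 (get 1 (var 19)) ;; assign 21 (get 0 (var 19)) ;;
              addArc (sub (var 3) (lit 1))))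
          (put 9 (var 4) (var 20) ;; assign 4 (add (var 4) (lit 1))))
        (.ite (.eq (get 2 (var 21)) (lit 1))
          (put 9 (var 4) (var 21) ;; assign 4 (add (var 4) (lit 1))) .skip) ;;
      assign 19 (add (var 19) (lit 1)))

/-- The whole program. -/
def main : Prog := prepare ;; windows ;; assign 0 (var 15)

end ViolatingCut

namespace ViolatingCut

open WordRAM Prog Expr Test

/-! ### Specifications -/

theorem choose_spec {w : ℕ} (hw : 1 < 2 ^ w) {s : State} (hb : 0 < s.reg 6)
    (hx : s.reg 10 < 2 ^ w) :
    WP w choose s (20 * s.reg 10 + 20)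
      (fun s' => s'.reg 11 = s.reg 10 % s.reg 6 ∧ s'.reg 10 = s.reg 10 / s.reg 6) := by
  have l1 : 1 % 2 ^ w = 1 := Nat.mod_eq_of_lt hw
  refine WP.mono (.seq (.of_run (T := 2) rfl (by decide) (.seq (T := 14 * s.reg 10 + 5) (T' := 4) (.mono
    (.loop (fun r s' => s'.reg 6 = s.reg 6 ∧ r = s'.reg 10 ∧
      s'.reg 10 + s.reg 6 * s'.reg 12 = s.reg 10) 9 (Q := fun s' => s'.reg 10 = s.reg 10 % s.reg 6 ∧
        s'.reg 12 = s.reg 10 / s.reg 6) ?_ (r := s.reg 10) ?_) ?_ ?_)))) ?_ (fun _ h => h)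
  · rintro r s' ⟨h6, rfl, h10⟩
    by_cases hlt : s'.reg 10 < s.reg 6
    · left
      refine ⟨?_, ?_⟩
      · simp [Test.Holds, Expr.eval, h6]; omega
      · rw [← h10, Nat.add_mul_mod_self_left, Nat.mod_eq_of_lt hlt,
          Nat.add_mul_div_left _ _ hb, Nat.div_eq_of_lt hlt]
        omega
    · right
      have h12 : s'.reg 12 + 1 ≤ s.reg 10 := by
        have : s'.reg 12 ≤ s.reg 6 * s'.reg 12 := Nat.le_mul_of_pos_left _ hb
        omega
      refine ⟨by simp [Test.Holds, Expr.eval, h6]; omega, .of_run rfl (by decide) ?_⟩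
      refine ⟨s'.reg 10 - s.reg 6, by omega, ?_⟩
      simp [Prog.run, Expr.eval, h6, l1, Nat.mod_eq_of_lt (show s'.reg 12 + 1 < 2 ^ w by omega)]
      rw [← h10, mul_add]
      omega
  · simp [Prog.run, Expr.eval]
  · simp [Test.cost, Expr.cost]
  · rintro s' ⟨h1, h2⟩
    refine .of_run rfl (by decide) ?_
    simp [Prog.run, Expr.eval, h1, h2]
  · omega

end ViolatingCut

namespace ViolatingCut

open WordRAM Prog Expr Test

/-- The memory holds the network `N` and the number `c`. -/
structure Holds (N : Net) (c : ℕ) (s : State) : Prop where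
  reg_c : s.reg 2 = c
  reg_M : s.reg 3 = N.M
  reg_k : s.reg 4 = N.k
  tail : s.arr 4 = N.tail
  head : s.arr 5 = N.head
  rev : s.arr 6 = N.rev
  term : s.arr 9 = N.term
  first : ∀ v, s.arr 7 v = Net.last N.head v N.M
  next : ∀ h < N.M, s.arr 8 h = Net.last N.head (N.head h) h

theorem Holds.of_frame {N : Net} {c : ℕ} {s s' : State} {p : Prog} (h : Holds N c s)
    (hf : Frame p s s') (hr : ∀ x ∈ [2, 3, 4], x ∉ p.wregs)
    (ha : ∀ a ∈ [4, 5, 6, 7, 8, 9], a ∉ p.warrs) : Holds N c s' := by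
  have r (x) (hx : x ∈ [2, 3, 4]) := hf.1 x (hr x hx)
  have a (x) (hx : x ∈ [4, 5, 6, 7, 8, 9]) := hf.2 x (ha x hx)
  constructor
  · rw [r 2 (by decide), h.reg_c]
  · rw [r 3 (by decide), h.reg_M]
  · rw [r 4 (by decide), h.reg_k]
  · rw [a 4 (by decide), h.tail]
  · rw [a 5 (by decide), h.head]
  · rw [a 6 (by decide), h.rev]
  · rw [a 9 (by decide), h.term]
  · rw [a 7 (by decide)]; exact h.first
  · rw [a 8 (by decide)]; exact h.next

/-- The memory also holds the size of a window and the base of the guesses. -/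
structure Env (N : Net) (c : ℕ) (s : State) : Prop extends Holds N c s where
  reg_W : s.reg 5 = min N.k (2 * c)
  reg_b : s.reg 6 = c + 1

theorem Env.of_frame {N : Net} {c : ℕ} {s s' : State} {p : Prog} (h : Env N c s)
    (hf : Frame p s s') (hr : ∀ x ∈ [2, 3, 4, 5, 6], x ∉ p.wregs)
    (ha : ∀ a ∈ [4, 5, 6, 7, 8, 9], a ∉ p.warrs) : Env N c s' := by
  refine ⟨h.toHolds.of_frame hf (fun x hx => hr x ?_) ha, ?_, ?_⟩
  · revert x; decide
  · rw [hf.1 5 (hr 5 (by decide)), h.reg_W]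
  · rw [hf.1 6 (hr 6 (by decide)), h.reg_b]

/-- Everything that is marked is in the queue. -/
def Tidy (s : State) : Prop :=
  ∀ x, s.arr 3 x ≠ 0 ∨ s.arr 12 x ≠ 0 → ∃ i < s.reg 17, s.arr 11 i = x

theorem reset_spec {w : ℕ} (hw : 1 < 2 ^ w) {s : State} (hs : Tidy s) :
    WP w reset s (20 * s.reg 17 + 5)
      (fun s' => (∀ x, s'.arr 3 x = 0) ∧ (∀ x, s'.arr 12 x = 0) ∧ s'.reg 17 = 0) := by
  have l1 : 1 % 2 ^ w = 1 := Nat.mod_eq_of_lt hw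
  refine WP.mono (.loop_frame (fun r s' => Tidy s' ∧ r = s'.reg 17) 12 ?_ ⟨hs, rfl⟩) ?_
    (fun _ h => h)
  · rintro r s' hf ⟨ht, rfl⟩
    by_cases h0 : s'.reg 17 = 0
    · left
      have : ∀ x, s'.arr 3 x = 0 ∧ s'.arr 12 x = 0 := by
        intro x
        by_contra hc
        obtain ⟨i, hi, -⟩ := ht x (by tauto)
        omega
      exact ⟨by simp [Test.Holds, Expr.eval, h0], fun x => (this x).1, fun x => (this x).2, h0⟩
    · right
      refine ⟨by simp [Test.Holds, Expr.eval]; omega, .of_run rfl (by decide) ?_⟩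
      refine ⟨s'.reg 17 - 1, by omega, ?_, ?_⟩
      · intro x
        simp only [Prog.run, Expr.eval, State.setReg_reg, State.setArr_reg, State.setReg_arr,
          State.setArr_arr, l1, Nat.zero_mod, Nat.reduceEqDiff, reduceIte]
        intro hx
        have hne : x ≠ s'.arr 11 (s'.reg 17 - 1) := by
          rintro rfl
          simp at hx
        rw [Function.update_of_ne hne, Function.update_of_ne hne] at hx
        obtain ⟨i, hi, rfl⟩ := ht x hx
        refine ⟨i, ?_, rfl⟩
        have : i ≠ s'.reg 17 - 1 := by rintro rfl; exact hne rfl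
        omega
      · simp [Prog.run, Expr.eval, l1]
  · simp [Test.cost, Expr.cost]
    omega

theorem pushSinks_spec {w : ℕ} {N : Net} {c : ℕ} {s : State} (hw : N.k + 1 < 2 ^ w)
    (he : Env N c s) (hst : s.reg 7 + min N.k (2 * c) ≤ N.k) (h3 : ∀ x, s.arr 3 x = 0)
    (h12 : ∀ x, s.arr 12 x = 0) (h17 : s.reg 17 = 0) :
    WP w pushSinks s (50 * N.k + 10)
      (fun s' => s'.reg 17 ≤ N.k ∧ ∀ f, N.IsTree (N.sinks (s.reg 7) (min N.k (2 * c)) (s.arr 13)) f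
        (s'.arr 3) (s'.arr 12) (s'.arr 11) (s'.reg 17)) := by
  have l1 : 1 % 2 ^ w = 1 := Nat.mod_eq_of_lt (by omega)
  have hW : min N.k (2 * c) ≤ N.k := min_le_left _ _
  obtain ⟨W, hWe⟩ : ∃ W, W = min N.k (2 * c) := ⟨_, rfl⟩
  have h5 := he.reg_W
  rw [← hWe] at hst hW h5 ⊢
  refine WP.mono (.seq (.of_run (T := 2) rfl (by decide) (.loop_frame (fun r s' => r = W - s'.reg 19 ∧
    s'.reg 19 ≤ W ∧ s'.reg 17 ≤ s'.reg 19 ∧ IsQueue (s'.arr 3) (s'.arr 11) (s'.reg 17) ∧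
    (∀ j < s'.reg 19, s.arr 13 j ≠ 0 → s'.arr 3 (N.term (s.reg 7 + j)) ≠ 0) ∧
    (∀ i < s'.reg 17, s'.arr 11 i ∈ N.sinks (s.reg 7) W (s.arr 13))) 36
    ?_ (r := W) ?_))) ?_ (fun _ h => h)
  · rintro r s' hf ⟨rfl, h19, h1719, hq, hmark, hmem⟩
    have e12 : s'.arr 12 = s.arr 12 := hf.2 12 (by decide)
    have e7 : s'.reg 7 = s.reg 7 := hf.1 7 (by decide)
    have e5 : s'.reg 5 = W := (hf.1 5 (by decide)).trans h5
    have e9 : s'.arr 9 = N.term := (hf.2 9 (by decide)).trans he.term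
    have e13 : s'.arr 13 = s.arr 13 := hf.2 13 (by decide)
    by_cases hlt : s'.reg 19 < W
    · right
      refine ⟨by simpa [Test.Holds, Expr.eval, e5] using hlt, .of_run rfl (by decide) ?_⟩
      have m1 : (s'.reg 19 + 1) % 2 ^ w = s'.reg 19 + 1 := Nat.mod_eq_of_lt (by omega)
      have m2 : (s'.reg 17 + 1) % 2 ^ w = s'.reg 17 + 1 := Nat.mod_eq_of_lt (by omega)
      have m3 : (s.reg 7 + s'.reg 19) % 2 ^ w = s.reg 7 + s'.reg 19 := Nat.mod_eq_of_lt (by omega)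
      refine ⟨W - (s'.reg 19 + 1), by omega, ?_⟩
      by_cases hl : 0 < s.arr 13 (s'.reg 19)
      · by_cases hv : s'.arr 3 (N.term (s.reg 7 + s'.reg 19)) = 0
        · simp [Prog.run, Expr.eval, Test.Holds, l1, m1, m2, m3, e7, e9, e13, hl, hv]
          refine ⟨by omega, by omega, hq.push hv, ?_, ?_⟩
          · intro j hj hj0
            rw [Function.update_apply]
            split_ifs with he
            · simp
            · refine hmark j ?_ hj0
              have : j ≠ s'.reg 19 := by rintro rfl; exact he rfl
              omega
          · intro i hi
            rw [Function.update_apply]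
            split_ifs with he
            · exact ⟨_, hlt, by omega, rfl⟩
            · exact hmem i (by omega)
        · simp [Prog.run, Expr.eval, Test.Holds, l1, m1, m3, e7, e9, e13, hl, hv]
          refine ⟨by omega, by omega, hq, ?_, hmem⟩
          intro j hj hj0
          rcases Nat.lt_or_eq_of_le hj with h | rfl
          · exact hmark j h hj0
          · exact hv
      · simp [Prog.run, Expr.eval, Test.Holds, l1, m1, e13, hl]
        refine ⟨by omega, by omega, hq, ?_, hmem⟩
        intro j hj hj0
        rcases Nat.lt_or_eq_of_le hj with h | rfl
        · exact hmark j h hj0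
        · omega
    · left
      refine ⟨by simpa [Test.Holds, Expr.eval, e5] using hlt, by omega, fun f => ⟨hq, ?_, ?_, ?_⟩⟩
      · intro x _
        rw [e12, h12 x]
      · rintro x ⟨j, hj, hj0, rfl⟩
        exact hmark j (by omega) hj0
      · intro i hi
        exact Or.inl ⟨by rw [e12]; exact h12 _, hmem i hi⟩
  · simp [Prog.run, Expr.eval, h17]
    exact ⟨by omega, by simp [h3], by simp [h3]⟩
  · simp [Test.cost, Expr.cost]
    omega

theorem explore_spec {w : ℕ} {N : Net} {c : ℕ} {s : State} (hw : 2 * (N.M + N.k) + 2 < 2 ^ w)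
    (he : Env N c s) {T : Set ℕ} (hk : s.reg 17 ≤ N.k)
    (ht : N.IsTree T (s.arr 10) (s.arr 3) (s.arr 12) (s.arr 11) (s.reg 17)) :
    WP w explore s (200 * (N.M + N.k) + 10)
      (fun s' => s'.reg 17 ≤ N.M + N.k ∧
        N.IsTree T (s.arr 10) (s'.arr 3) (s'.arr 12) (s'.arr 11) (s'.reg 17) ∧
        ∀ h < N.M, s'.arr 3 (N.head h) ≠ 0 → s'.arr 3 (N.tail h) ≠ 0 ∨ s.arr 10 h ≠ 0) := by
  have l1 : 1 % 2 ^ w = 1 := Nat.mod_eq_of_lt (by omega)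
  refine WP.mono (.seq (.of_run (T := 2) rfl (by decide) (.seq (.of_run (T := 2) rfl (by decide)
    (.loop_frame (fun r s' => ∃ D : Finset ℕ, s'.reg 17 ≤ N.k + D.card ∧
      r = 2 * (N.M - D.card) + (s'.reg 17 - s'.reg 16) ∧
      N.IsDone (s'.arr 11) (s'.reg 16) (s'.reg 18) D ∧
      N.IsScan T (s.arr 10) (s'.arr 3) (s'.arr 12) (s'.arr 11) (s'.reg 17) (s'.reg 16) (s'.reg 18))
      50 ?_ (r := 2 * N.M + s.reg 17) ?_))))) ?_ (fun _ h => h)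
  · rintro r s' hf ⟨D, hD17, rfl, hD, hs⟩
    have e7 (v) : s'.arr 7 v = Net.last N.head v N.M :=
      (congrFun (hf.2 7 (by decide)) v).trans (he.first v)
    have e8 (h) (hh : h < N.M) : s'.arr 8 h = Net.last N.head (N.head h) h :=
      (congrFun (hf.2 8 (by decide)) h).trans (he.next h hh)
    have e4 : s'.arr 4 = N.tail := (hf.2 4 (by decide)).trans he.tail
    have e10 : s'.arr 10 = s.arr 10 := hf.2 10 (by decide)
    have hc := hD.card_le
    have hle := hs.le
    have h18 : s'.reg 18 ≤ N.M := by
      by_cases h : s'.reg 18 = 0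
      · omega
      · exact (hs.cur_spec h).2.1
    have m0 : (s'.reg 17 + s'.reg 18) % 2 ^ w = s'.reg 17 + s'.reg 18 :=
      Nat.mod_eq_of_lt (by omega)
    by_cases hlt : s'.reg 16 < s'.reg 17 + s'.reg 18
    · right
      refine ⟨by simpa [Test.Holds, Expr.eval, m0] using hlt, .of_run rfl (by decide) ?_⟩
      by_cases h0 : s'.reg 18 = 0
      · refine ⟨2 * (N.M - D.card) + (s'.reg 17 - (s'.reg 16 + 1)), by omega, D, ?_⟩
        have m1 : (s'.reg 16 + 1) % 2 ^ w = s'.reg 16 + 1 := Nat.mod_eq_of_lt (by omega)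
        simp [Prog.run, Expr.eval, Test.Holds, l1, m1, e7, h0]
        rw [h0] at hs
        exact ⟨hD17, hD.advance _, hs.advance (by omega)⟩
      · have hM : s'.reg 18 - 1 < N.M := by omega
        have hnot := hs.notMem hD h0
        have hcard : (insert (s'.reg 18 - 1) D).card = D.card + 1 := Finset.card_insert_of_notMem hnot
        have hD' := hs.isDone_insert hD h0
        have hc' := hD'.card_le
        rw [hcard] at hc'
        have m1 : (s'.reg 17 + 1) % 2 ^ w = s'.reg 17 + 1 := Nat.mod_eq_of_lt (by omega)
        have m2 : (s'.reg 18 - 1 + 1) % 2 ^ w = s'.reg 18 - 1 + 1 := Nat.mod_eq_of_lt (by omega)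
        by_cases hfl : s.arr 10 (s'.reg 18 - 1) = 0
        · by_cases hv : s'.arr 3 (N.tail (s'.reg 18 - 1)) = 0
          · refine ⟨2 * (N.M - (D.card + 1)) + (s'.reg 17 + 1 - s'.reg 16), by omega,
              insert (s'.reg 18 - 1) D, ?_⟩
            simp [Prog.run, Expr.eval, Test.Holds, l1, m1, m2, e4, e8 _ hM, e10, h0, hfl, hv, hcard]
            refine ⟨by omega, hD'.congr fun i hi => ?_, ?_⟩
            · rw [Function.update_of_ne (by omega)]
            · exact (hs.push h0 hv hfl).next h0 (Or.inl (by simp))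
          · refine ⟨2 * (N.M - (D.card + 1)) + (s'.reg 17 - s'.reg 16), by omega,
              insert (s'.reg 18 - 1) D, ?_⟩
            simp [Prog.run, Expr.eval, Test.Holds, l1, e4, e8 _ hM, e10, h0, hfl, hv, hcard]
            exact ⟨by omega, hD', hs.next h0 (Or.inl hv)⟩
        · refine ⟨2 * (N.M - (D.card + 1)) + (s'.reg 17 - s'.reg 16), by omega,
              insert (s'.reg 18 - 1) D, ?_⟩
          simp [Prog.run, Expr.eval, Test.Holds, l1, e8 _ hM, e10, h0, hfl, hcard]
          exact ⟨by omega, hD', hs.next h0 (Or.inr hfl)⟩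
    · left
      have h1 : s'.reg 16 = s'.reg 17 := by omega
      have h2 : s'.reg 18 = 0 := by omega
      refine ⟨by simpa [Test.Holds, Expr.eval, m0] using hlt, by omega, hs.toIsTree, ?_⟩
      intro h hh hv
      obtain ⟨i, hi, hq⟩ := (hs.vis_iff _).1 hv
      exact hs.closed h hh i (by omega) hq.symm (Or.inr (by omega))
  · refine ⟨∅, ?_⟩
    simp [Prog.run, Expr.eval]
    refine ⟨hk, ?_, ht, by omega, fun h => absurd rfl h, fun h _ i hi => absurd hi (by omega)⟩
    intro h hh
    simp at hh
  · simp [Test.cost, Expr.cost]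
    omega

end ViolatingCut

namespace ViolatingCut

open WordRAM Prog Expr Test

theorem search_spec {w : ℕ} {N : Net} {c : ℕ} {s : State} (hw : 2 * (N.M + N.k) + 2 < 2 ^ w)
    (he : Env N c s) (hst : s.reg 7 + min N.k (2 * c) ≤ N.k) (hs : Tidy s)
    (h17 : s.reg 17 ≤ N.M + N.k) :
    WP w search s (300 * (N.M + N.k) + 30)
      (fun s' => s'.reg 17 ≤ N.M + N.k ∧
        N.IsTree (N.sinks (s.reg 7) (min N.k (2 * c)) (s.arr 13)) (s.arr 10) (s'.arr 3) (s'.arr 12)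
          (s'.arr 11) (s'.reg 17) ∧
        ∀ h < N.M, s'.arr 3 (N.head h) ≠ 0 → s'.arr 3 (N.tail h) ≠ 0 ∨ s.arr 10 h ≠ 0) := by
  refine WP.mono (.seq ((reset_spec (by omega) hs).frame.mono le_rfl ?_))
    (T := 20 * s.reg 17 + 5 + (50 * N.k + 10 + (200 * (N.M + N.k) + 10))) (by omega) (fun _ h => h)
  rintro s₁ ⟨⟨h3, h12, h17'⟩, hf₁⟩
  have he₁ := he.of_frame hf₁ (by decide) (by decide)
  have e7 : s₁.reg 7 = s.reg 7 := hf₁.1 7 (by decide)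
  have e13 : s₁.arr 13 = s.arr 13 := hf₁.2 13 (by decide)
  have e10 : s₁.arr 10 = s.arr 10 := hf₁.2 10 (by decide)
  refine .seq ((pushSinks_spec (by omega) he₁ (by rwa [e7]) h3 h12 h17').frame.mono le_rfl ?_)
  rintro s₂ ⟨⟨hk, ht⟩, hf₂⟩
  have e10' : s₂.arr 10 = s.arr 10 := (hf₂.2 10 (by decide)).trans e10
  rw [e7, e13] at ht
  refine (explore_spec hw (he₁.of_frame hf₂ (by decide) (by decide)) hk (ht _)).mono le_rfl ?_
  rw [e10']
  exact fun _ h => h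

theorem scanArcs_spec {w : ℕ} {N : Net} {c : ℕ} {s : State} (hw : N.M + 1 < 2 ^ w)
    (he : Env N c s) :
    WP w scanArcs s (60 * N.M + 20)
      (fun s' => s'.reg 21 = N.cut {x | s.arr 3 x = 0} ∧
        s'.reg 20 = N.pick {x | s.arr 3 x = 0} (s.reg 13) (s.reg 11) N.M) := by
  have l1 : 1 % 2 ^ w = 1 := Nat.mod_eq_of_lt (by omega)
  set R := {x | s.arr 3 x = 0} with hR
  refine WP.mono (.seq (.of_run (T := 2) rfl (by decide) (.seq (.of_run (T := 2) rfl (by decide)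
    (.seq (.of_run (T := 2) rfl (by decide) (.loop_frame (fun r s' => r = N.M - s'.reg 19 ∧
    s'.reg 19 ≤ N.M ∧ s'.reg 21 = cnt (fun h => N.tail h ∈ R ∧ N.head h ∉ R) (s'.reg 19) ∧
    s'.reg 20 = N.pick R (s.reg 13) (s.reg 11) (s'.reg 19)) 40
    ?_ (r := N.M) ?_))))))) ?_ (fun _ h => h)
  · rintro r s' hf ⟨rfl, h19, h21, h20⟩
    have e3 : s'.arr 3 = s.arr 3 := hf.2 3 (by decide)
    have e11 : s'.reg 11 = s.reg 11 := hf.1 11 (by decide)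
    have eM : s'.reg 3 = N.M := (hf.1 3 (by decide)).trans he.reg_M
    have e4 : s'.arr 4 = N.tail := (hf.2 4 (by decide)).trans he.tail
    have e5 : s'.arr 5 = N.head := (hf.2 5 (by decide)).trans he.head
    by_cases hlt : s'.reg 19 < N.M
    · right
      refine ⟨by simpa [Test.Holds, Expr.eval, eM] using hlt, .of_run rfl (by decide) ?_⟩
      refine ⟨N.M - (s'.reg 19 + 1), by omega, ?_⟩
      have hcnt := cnt_le_self (fun h => N.tail h ∈ R ∧ N.head h ∉ R) (s'.reg 19)
      have m1 : (s'.reg 19 + 1) % 2 ^ w = s'.reg 19 + 1 := Nat.mod_eq_of_lt (by omega)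
      have m2 : (s'.reg 21 + 1) % 2 ^ w = s'.reg 21 + 1 := Nat.mod_eq_of_lt (by omega)
      by_cases ht : s.arr 3 (N.tail (s'.reg 19)) = 0
      · by_cases hh : 0 < s.arr 3 (N.head (s'.reg 19))
        · have hc : N.tail (s'.reg 19) ∈ R ∧ N.head (s'.reg 19) ∉ R := ⟨ht, hh.ne'⟩
          by_cases hd : s'.reg 21 + 1 = s.reg 11
          · have m3 : s.reg 11 % 2 ^ w = s.reg 11 := by rw [← hd]; exact m2
            simp [Prog.run, Expr.eval, Test.Holds, l1, m1, m3, e3, e4, e5, e11, ht, hh, hd]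
            refine ⟨by omega, ?_, ?_⟩
            · rw [cnt_succ_of_pos (p := fun h => N.tail h ∈ R ∧ N.head h ∉ R) hc, ← h21, hd]
            · rw [Net.pick, if_pos ⟨hc, by rw [← h21, hd]⟩]
          · simp [Prog.run, Expr.eval, Test.Holds, l1, m1, m2, e3, e4, e5, e11, ht, hh, hd]
            refine ⟨by omega, ?_, ?_⟩
            · rw [cnt_succ_of_pos (p := fun h => N.tail h ∈ R ∧ N.head h ∉ R) hc, ← h21]
            · rw [Net.pick, if_neg (by rw [← h21]; tauto), h20]
        · have hc : ¬ (N.tail (s'.reg 19) ∈ R ∧ N.head (s'.reg 19) ∉ R) :=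
            fun h => hh (Nat.pos_of_ne_zero h.2)
          simp [Prog.run, Expr.eval, Test.Holds, l1, m1, e3, e4, e5, ht, hh]
          refine ⟨by omega, ?_, ?_⟩
          · rw [cnt_succ_of_neg (p := fun h => N.tail h ∈ R ∧ N.head h ∉ R) hc, ← h21]
          · rw [Net.pick, if_neg (by tauto), h20]
      · have hc : ¬ (N.tail (s'.reg 19) ∈ R ∧ N.head (s'.reg 19) ∉ R) := fun h => ht h.1
        simp [Prog.run, Expr.eval, Test.Holds, l1, m1, e3, e4, ht]
        refine ⟨by omega, ?_, ?_⟩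
        · rw [cnt_succ_of_neg (p := fun h => N.tail h ∈ R ∧ N.head h ∉ R) hc, ← h21]
        · rw [Net.pick, if_neg (by tauto), h20]
    · left
      have : s'.reg 19 = N.M := by omega
      rw [this] at h21 h20
      exact ⟨by simpa [Test.Holds, Expr.eval, eM] using hlt, h21, h20⟩
  · simp [Prog.run, Expr.eval, cnt_zero, Net.pick]
  · simp [Test.cost, Expr.cost]
    omega

theorem scanTerms_spec {w : ℕ} {N : Net} {c : ℕ} {s : State} (hw : N.k + 1 < 2 ^ w)
    (he : Env N c s) :
    WP w scanTerms s (40 * N.k + 20)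
      (fun s' => s'.reg 22 = N.dem {x | s.arr 3 x = 0} ∧
        s'.reg 23 = N.dem {x | s.arr 3 x = 0}ᶜ) := by
  have l1 : 1 % 2 ^ w = 1 := Nat.mod_eq_of_lt (by omega)
  set R := {x | s.arr 3 x = 0} with hR
  refine WP.mono (.seq (.of_run (T := 2) rfl (by decide) (.seq (.of_run (T := 2) rfl (by decide)
    (.seq (.of_run (T := 2) rfl (by decide) (.loop_frame (fun r s' => r = N.k - s'.reg 19 ∧
    s'.reg 19 ≤ N.k ∧ s'.reg 22 = cnt (fun j => N.term j ∈ R) (s'.reg 19) ∧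
    s'.reg 23 = cnt (fun j => N.term j ∈ Rᶜ) (s'.reg 19)) 25
    ?_ (r := N.k) ?_))))))) ?_ (fun _ h => h)
  · rintro r s' hf ⟨rfl, h19, h22, h23⟩
    have e3 : s'.arr 3 = s.arr 3 := hf.2 3 (by decide)
    have ek : s'.reg 4 = N.k := (hf.1 4 (by decide)).trans he.reg_k
    have e9 : s'.arr 9 = N.term := (hf.2 9 (by decide)).trans he.term
    by_cases hlt : s'.reg 19 < N.k
    · right
      refine ⟨by simpa [Test.Holds, Expr.eval, ek] using hlt, .of_run rfl (by decide) ?_⟩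
      refine ⟨N.k - (s'.reg 19 + 1), by omega, ?_⟩
      have c1 := cnt_le_self (fun j => N.term j ∈ R) (s'.reg 19)
      have c2 := cnt_le_self (fun j => N.term j ∈ Rᶜ) (s'.reg 19)
      have m1 : (s'.reg 19 + 1) % 2 ^ w = s'.reg 19 + 1 := Nat.mod_eq_of_lt (by omega)
      have m2 : (s'.reg 22 + 1) % 2 ^ w = s'.reg 22 + 1 := Nat.mod_eq_of_lt (by omega)
      have m3 : (s'.reg 23 + 1) % 2 ^ w = s'.reg 23 + 1 := Nat.mod_eq_of_lt (by omega)
      by_cases ht : s.arr 3 (N.term (s'.reg 19)) = 0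
      · have hin : N.term (s'.reg 19) ∈ R := ht
        simp [Prog.run, Expr.eval, Test.Holds, l1, m1, m2, e3, e9, ht]
        refine ⟨by omega, ?_, ?_⟩
        · rw [cnt_succ_of_pos (p := fun j => N.term j ∈ R) hin, ← h22]
        · rw [h23]
          exact (cnt_succ_of_neg (p := fun j => N.term j ∈ Rᶜ) (not_not.2 hin)).symm
      · have hin : N.term (s'.reg 19) ∉ R := ht
        simp [Prog.run, Expr.eval, Test.Holds, l1, m1, m3, e3, e9, ht]
        refine ⟨by omega, ?_, ?_⟩
        · rw [cnt_succ_of_neg (p := fun j => N.term j ∈ R) hin, ← h22]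
        · rw [h23]
          exact (cnt_succ_of_pos (p := fun j => N.term j ∈ Rᶜ) hin).symm
    · left
      have : s'.reg 19 = N.k := by omega
      rw [this] at h22 h23
      exact ⟨by simpa [Test.Holds, Expr.eval, ek] using hlt, h22, h23⟩
  · simp [Prog.run, Expr.eval, cnt_zero]
  · simp [Test.cost, Expr.cost]
    omega

theorem augment_spec {w : ℕ} {N : Net} {c : ℕ} {s : State} (hw : 1 < 2 ^ w)
    (he : Env N c s) {T : Set ℕ} (hf : N.IsPreflow (s.arr 10))
    (ht : N.IsTree T (s.arr 10) (s.arr 3) (s.arr 12) (s.arr 11) (s.reg 17)) :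
    WP w augment s (40 * s.reg 17 + 5)
      (fun s' => N.IsPreflow (s'.arr 10) ∧ ∀ U, Disjoint U T → N.net (s'.arr 10) U =
        N.net (s.arr 10) U + if s.arr 3 (s.reg 20) = 0 then 0 else Net.ind U (s.reg 20)) := by
  have l1 : 1 % 2 ^ w = 1 := Nat.mod_eq_of_lt hw
  by_cases hv : s.arr 3 (s.reg 20) = 0
  · refine ⟨s, _, .while_false ?_, ?_, hf, ?_⟩
    · simp [Test.Holds, Expr.eval, ht.par_eq_zero _ hv]
    · simp [Test.cost, Expr.cost]
    · simp [hv]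
  obtain ⟨i₀, hi₀, hq₀⟩ := (ht.vis_iff _).1 hv
  refine WP.mono (.loop_frame (fun r s' => r < s.reg 17 ∧ s'.reg 20 = s.arr 11 r ∧
    N.IsPreflow (s'.arr 10) ∧ (∀ i ≤ r, ∀ h, s.arr 12 (s.arr 11 i) = h + 1 → s'.arr 10 h = 0) ∧
    ∀ U, N.net (s'.arr 10) U =
      N.net (s.arr 10) U + Net.ind U (s.reg 20) - Net.ind U (s'.reg 20)) 20
    ?_ (r := i₀) ?_) ?_ (fun _ h => h)
  · rintro r s' hfr ⟨hr, h20, hpre, hz, hnet⟩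
    have e12 : s'.arr 12 = s.arr 12 := hfr.2 12 (by decide)
    have e5 : s'.arr 5 = N.head := (hfr.2 5 (by decide)).trans he.head
    have e6 : s'.arr 6 = N.rev := (hfr.2 6 (by decide)).trans he.rev
    rcases ht.par_spec r hr with ⟨hp, hT⟩ | ⟨h, hh, hp, htail, -, j, hj, hhead⟩
    · left
      refine ⟨by simp [Test.Holds, Expr.eval, e12, h20, hp], hpre, fun U hU => ?_⟩
      have : Net.ind U (s'.reg 20) = 0 := by
        rw [h20]
        exact if_neg fun hm => Set.disjoint_left.1 hU hm hT
      rw [hnet, this, if_neg hv, sub_zero]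
    · right
      have hh0 := hz r le_rfl h hp
      refine ⟨by simp [Test.Holds, Expr.eval, e12, h20, hp], .of_run rfl (by decide) ⟨j, hj, ?_⟩⟩
      have e10 : (Prog.run w (assign 19 (sub (get 12 (var 20)) (lit 1)) ;;
          .ite (.eq (get 10 (get 6 (var 19))) (lit 1)) (put 10 (get 6 (var 19)) (lit 0))
            (put 10 (var 19) (lit 1)) ;; assign 20 (get 5 (var 19))) s').arr 10 =
          N.send (s'.arr 10) h := by
        by_cases h1 : s'.arr 10 (N.rev h) = 1
        · simp [Prog.run, Expr.eval, Test.Holds, l1, e12, e6, h20, hp, h1, Net.send]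
        · simp [Prog.run, Expr.eval, Test.Holds, l1, e12, e6, h20, hp, h1, Net.send]
      have e20 : (Prog.run w (assign 19 (sub (get 12 (var 20)) (lit 1)) ;;
          .ite (.eq (get 10 (get 6 (var 19))) (lit 1)) (put 10 (get 6 (var 19)) (lit 0))
            (put 10 (var 19) (lit 1)) ;; assign 20 (get 5 (var 19))) s').reg 20 = N.head h := by
        by_cases h1 : s'.arr 10 (N.rev h) = 1
        · simp [Prog.run, Expr.eval, Test.Holds, l1, e12, e5, e6, h20, hp, h1]
        · simp [Prog.run, Expr.eval, Test.Holds, l1, e12, e5, e6, h20, hp, h1]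
      rw [e10, e20]
      refine ⟨by omega, hhead, hpre.send hh, fun i hi g hg => ?_, fun U => ?_⟩
      · refine N.send_eq_zero (hz i (by omega) g hg) ?_
        rintro rfl
        rcases ht.par_spec i (by omega) with ⟨hp', -⟩ | ⟨g', -, hp', htail', -⟩
        · omega
        · obtain rfl : g = g' := by omega
          have := ht.inj i (by omega) r hr (by rw [← htail, ← htail'])
          omega
      · rw [N.net_send hh hh0, hnet, h20, htail]
        ring
  · refine ⟨hi₀, hq₀.symm, hf, fun i hi h hp => ?_, fun U => by ring⟩
    rcases ht.par_spec i (by omega) with ⟨hp', -⟩ | ⟨g', -, hp', -, h0, -⟩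
    · omega
    · obtain rfl : h = g' := by omega
      exact h0
  · have := Nat.mul_le_mul_left 40 hi₀.le
    simp [Test.cost, Expr.cost]
    omega

theorem round_spec {w : ℕ} {N : Net} {c : ℕ} {s : State} (hw : 2 * (N.M + N.k) + 2 < 2 ^ w)
    (he : Env N c s) (hst : s.reg 7 + min N.k (2 * c) ≤ N.k) (hs : Tidy s)
    (h17 : s.reg 17 ≤ N.M + N.k) (h15 : s.reg 15 = 0) (hx : s.reg 10 < 2 ^ w)
    {T : Set ℕ} (hT : T = N.sinks (s.reg 7) (min N.k (2 * c)) (s.arr 13)) {l : List ℕ}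
    (hfl : N.IsFlow T l (s.arr 10)) :
    WP w round s (500 * (N.M + N.k) + 20 * s.reg 10 + 150)
      (fun s' => Tidy s' ∧ s'.reg 17 ≤ N.M + N.k ∧
        ((s'.reg 15 = 1 ∧ s'.reg 14 = 0 ∧ N.Viol c {x | s'.arr 3 x = 0} ∧ ∀ x, s'.arr 3 x ≤ 1) ∨
        (s'.reg 15 = 0 ∧ s'.reg 14 = s.reg 14 - 1 ∧ s'.reg 10 = s.reg 10 / (c + 1) ∧
          N.cut (N.satur T l) ≤ mult l (N.satur T l) ∧ ¬ N.Viol c (N.satur T l) ∧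
          N.IsFlow T (N.nextSrcs T (s.reg 13) (s.reg 10 % (c + 1)) l) (s'.arr 10)))) := by
  have l1 : 1 % 2 ^ w = 1 := Nat.mod_eq_of_lt (by omega)
  subst hT
  refine WP.mono (.seq ((search_spec hw he hst hs h17).frame.mono le_rfl ?_))
    (T := 300 * (N.M + N.k) + 30 + (20 * s.reg 10 + 20 + (60 * N.M + 20 + (40 * N.k + 20 + (20 +
      (10 + (40 * (N.M + N.k) + 20))))))) (by omega) (fun _ h => h)
  set T := N.sinks (s.reg 7) (min N.k (2 * c)) (s.arr 13)
  rintro s₁ ⟨⟨h17₁, ht, hclosed⟩, hf₁⟩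
  have he₁ := he.of_frame hf₁ (by decide) (by decide)
  have e10 : s₁.reg 10 = s.reg 10 := hf₁.1 10 (by decide)
  refine .seq ((choose_spec (by omega) (by rw [he₁.reg_b]; omega) (by rwa [e10])).frame.mono
    (by rw [e10]) ?_)
  rintro s₂ ⟨⟨h11, h10⟩, hf₂⟩
  have he₂ := he₁.of_frame hf₂ (by decide) (by decide)
  refine .seq ((scanArcs_spec (by omega) he₂).frame.mono le_rfl ?_)
  rintro s₃ ⟨⟨h21, h20⟩, hf₃⟩
  have he₃ := he₂.of_frame hf₃ (by decide) (by decide)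
  refine .seq ((scanTerms_spec (by omega) he₃).frame.mono le_rfl ?_)
  rintro s₄ ⟨⟨h22, h23⟩, hf₄⟩
  have he₄ := he₃.of_frame hf₄ (by decide) (by decide)
  have a3₂ : s₂.arr 3 = s₁.arr 3 := hf₂.2 3 (by decide)
  have a3₃ : s₃.arr 3 = s₁.arr 3 := (hf₃.2 3 (by decide)).trans a3₂
  have a3₄ : s₄.arr 3 = s₁.arr 3 := (hf₄.2 3 (by decide)).trans a3₃
  have a10₁ : s₁.arr 10 = s.arr 10 := hf₁.2 10 (by decide)
  have a10₄ : s₄.arr 10 = s.arr 10 := by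
    rw [hf₄.2 10 (by decide), hf₃.2 10 (by decide), hf₂.2 10 (by decide), a10₁]
  have a11₄ : s₄.arr 11 = s₁.arr 11 := by
    rw [hf₄.2 11 (by decide), hf₃.2 11 (by decide), hf₂.2 11 (by decide)]
  have a12₄ : s₄.arr 12 = s₁.arr 12 := by
    rw [hf₄.2 12 (by decide), hf₃.2 12 (by decide), hf₂.2 12 (by decide)]
  have r17₄ : s₄.reg 17 = s₁.reg 17 := by
    rw [hf₄.1 17 (by decide), hf₃.1 17 (by decide), hf₂.1 17 (by decide)]
  have r15₄ : s₄.reg 15 = 0 := by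
    rw [hf₄.1 15 (by decide), hf₃.1 15 (by decide), hf₂.1 15 (by decide), hf₁.1 15 (by decide), h15]
  have r14₄ : s₄.reg 14 = s.reg 14 := by
    rw [hf₄.1 14 (by decide), hf₃.1 14 (by decide), hf₂.1 14 (by decide), hf₁.1 14 (by decide)]
  have r13₂ : s₂.reg 13 = s.reg 13 := by
    rw [hf₂.1 13 (by decide), hf₁.1 13 (by decide)]
  have r10₄ : s₄.reg 10 = s.reg 10 / (c + 1) := by
    rw [hf₄.1 10 (by decide), hf₃.1 10 (by decide), h10, e10, he₁.reg_b]
  have r20₄ : s₄.reg 20 = s₃.reg 20 := hf₄.1 20 (by decide)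
  have r21₄ : s₄.reg 21 = s₃.reg 21 := hf₄.1 21 (by decide)
  rw [a3₂] at h21 h20
  rw [a3₃] at h22 h23
  rw [r13₂, h11, e10, he₁.reg_b] at h20
  set R := {x | s₁.arr 3 x = 0} with hR
  have hRV : R = {x | s₁.arr 3 x ≠ 0}ᶜ := by ext x; simp [hR]
  have hsat : N.satur T l = R ∧ N.cut (N.satur T l) ≤ mult l (N.satur T l) := by
    rw [hRV]
    refine N.satur_eq hfl (fun x hx => ht.sub x hx) ?_ (fun U hU hU' => ht.disjoint hU hU')
    intro h hh hv hv'
    have h1 := hclosed h hh hv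
    have h2 := hfl.le_one h hh
    have h3 : s₁.arr 3 (N.tail h) = 0 := by simpa using hv'
    omega
  have htidy : ∀ s' : State, s'.arr 3 = s₁.arr 3 → s'.arr 12 = s₁.arr 12 →
      s'.arr 11 = s₁.arr 11 → s'.reg 17 = s₁.reg 17 → Tidy s' := by
    intro s' e1 e2 e3 e4 x hx
    rw [e1, e2] at hx
    rw [e3, e4, ← ht.vis_iff]
    intro h0
    have := ht.par_eq_zero x h0
    tauto
  by_cases hviol : N.Viol c R
  · obtain ⟨v1, v2, v3⟩ := hviol
    have hrun : verdict.run w s₄ = s₄.setReg 15 1 := by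
      have w1 : s₄.reg 21 < s₄.reg 22 := by rw [r21₄, h21, h22]; exact v1
      have w2 : s₄.reg 21 < s₄.reg 23 := by rw [r21₄, h21, h23]; exact v2
      have w3 : s₄.reg 21 < s₄.reg 2 := by rw [r21₄, h21, he₄.reg_c]; exact v3
      simp [verdict, Prog.run, Test.Holds, Expr.eval, w1, w2, w3, l1]
    refine .seq (.of_run rfl (by decide) ?_)
    rw [hrun]
    refine WP.mono (.ite (T := 2) (fun _ => .of_run rfl (by decide) ?_) (fun h => ?_)) (by
      simp [Test.cost, Expr.cost]; omega) (fun _ h => h)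
    · refine ⟨htidy _ ?_ ?_ ?_ ?_, ?_, Or.inl ⟨?_, ?_, ?_, ?_⟩⟩
      · simp [Prog.run, a3₄]
      · simp [Prog.run, a12₄]
      · simp [Prog.run, a11₄]
      · simp [Prog.run, r17₄]
      · simp [Prog.run, r17₄, h17₁]
      · simp [Prog.run]
      · simp [Prog.run, Expr.eval]
      · simp only [Prog.run, State.setReg_arr, a3₄]
        exact ⟨v1, v2, v3⟩
      · simp only [Prog.run, State.setReg_arr, a3₄]
        exact ht.vis_le
    · simp [Test.Holds, Expr.eval, l1] at h
  · have hrun : verdict.run w s₄ = s₄ := by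
      have w1 : ¬ (s₄.reg 21 < s₄.reg 22 ∧ s₄.reg 21 < s₄.reg 23 ∧ s₄.reg 21 < s₄.reg 2) := by
        rw [r21₄, h21, h22, h23, he₄.reg_c]
        exact hviol
      by_cases q1 : s₄.reg 21 < s₄.reg 22
      · by_cases q2 : s₄.reg 21 < s₄.reg 23
        · have q3 : ¬ s₄.reg 21 < s₄.reg 2 := fun h => w1 ⟨q1, q2, h⟩
          simp [verdict, Prog.run, Test.Holds, Expr.eval, q3]
        · simp [verdict, Prog.run, Test.Holds, Expr.eval, q2]
      · simp [verdict, Prog.run, Test.Holds, Expr.eval, q1]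
    refine .seq (.of_run rfl (by decide) ?_)
    rw [hrun]
    refine WP.mono (.ite (T := 40 * s₄.reg 17 + 5 + 10) (fun h => ?_) (fun _ => .seq
      ((augment_spec (by omega) he₄ (T := T) ?_ ?_).frame.mono le_rfl ?_))) ?_ (fun _ h => h)
    · simp [Test.Holds, Expr.eval, l1, r15₄] at h
    · rw [a10₄]
      exact hfl.toIsPreflow
    · rw [a10₄, a3₄, a12₄, a11₄, r17₄]
      exact ht
    · rintro s₅ ⟨⟨hpre, hnet⟩, hf₅⟩
      refine .of_run rfl (by decide) ?_
      have q3 : s₅.arr 3 = s₁.arr 3 := (hf₅.2 3 (by decide)).trans a3₄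
      have q12 : s₅.arr 12 = s₁.arr 12 := (hf₅.2 12 (by decide)).trans a12₄
      have q11 : s₅.arr 11 = s₁.arr 11 := (hf₅.2 11 (by decide)).trans a11₄
      have q17 : s₅.reg 17 = s₁.reg 17 := (hf₅.1 17 (by decide)).trans r17₄
      have q15 : s₅.reg 15 = 0 := (hf₅.1 15 (by decide)).trans r15₄
      have q14 : s₅.reg 14 = s.reg 14 := (hf₅.1 14 (by decide)).trans r14₄
      have q10 : s₅.reg 10 = s.reg 10 / (c + 1) := (hf₅.1 10 (by decide)).trans r10₄
      refine ⟨htidy _ ?_ ?_ ?_ ?_, ?_, Or.inr ⟨?_, ?_, ?_, hsat.2, ?_, ?_⟩⟩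
      · simp [Prog.run, q3]
      · simp [Prog.run, q12]
      · simp [Prog.run, q11]
      · simp [Prog.run, q17]
      · simp [Prog.run, q17, h17₁]
      · simp [Prog.run, q15]
      · simp [Prog.run, Expr.eval, q14, l1]
      · simp [Prog.run, q10]
      · rw [hsat.1]
        exact hviol
      · simp only [Prog.run, State.setReg_arr]
        refine ⟨hpre, fun U hU => ?_⟩
        rw [hnet U hU, a10₄, a3₄, r20₄, hfl.net_eq U hU, Net.nextSrcs, hsat.1, ← h20]
        have hmem : s₃.reg 20 ∈ R ↔ s₁.arr 3 (s₃.reg 20) = 0 := Iff.rfl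
        by_cases hv : s₃.reg 20 ∈ R
        · rw [if_pos hv, if_pos (hmem.1 hv), add_zero]
        · rw [if_neg hv, if_neg (fun h => hv (hmem.2 h)), mult_cons]
          simp only [Net.ind]
          push_cast
          rfl
    · rw [r17₄]
      simp [Test.cost, Expr.cost]
      omega

end ViolatingCut

namespace ViolatingCut

open WordRAM Prog Expr Test

theorem clearFlow_spec {w : ℕ} {N : Net} {c : ℕ} {s : State} (hw : N.M + 1 < 2 ^ w)
    (he : Env N c s) :
    WP w clearFlow s (20 * N.M + 10) (fun s' => ∀ h < N.M, s'.arr 10 h = 0) := by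
  have l1 : 1 % 2 ^ w = 1 := Nat.mod_eq_of_lt (by omega)
  refine WP.mono (.seq (.of_run (T := 2) rfl (by decide) (.loop_frame (fun r s' =>
    r = N.M - s'.reg 19 ∧ s'.reg 19 ≤ N.M ∧ ∀ h < s'.reg 19, s'.arr 10 h = 0) 12
    ?_ (r := N.M) ?_))) ?_ (fun _ h => h)
  · rintro r s' hf ⟨rfl, h19, h10⟩
    have eM : s'.reg 3 = N.M := (hf.1 3 (by decide)).trans he.reg_M
    by_cases hlt : s'.reg 19 < N.M
    · right
      refine ⟨by simpa [Test.Holds, Expr.eval, eM] using hlt, .of_run rfl (by decide) ?_⟩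
      refine ⟨N.M - (s'.reg 19 + 1), by omega, ?_⟩
      have m1 : (s'.reg 19 + 1) % 2 ^ w = s'.reg 19 + 1 := Nat.mod_eq_of_lt (by omega)
      simp [Prog.run, Expr.eval, l1, m1]
      refine ⟨by omega, fun h hh => ?_⟩
      rw [Function.update_apply]
      split_ifs
      · rfl
      · exact h10 h (by omega)
    · left
      have : s'.reg 19 = N.M := by omega
      rw [this] at h10
      exact ⟨by simpa [Test.Holds, Expr.eval, eM] using hlt, h10⟩
  · simp [Prog.run, Expr.eval]
  · simp [Test.cost, Expr.cost]
    omega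

theorem labels_spec {w : ℕ} {N : Net} {c : ℕ} {s : State} (hw : N.k + 1 < 2 ^ w)
    (he : Env N c s) (hst : s.reg 7 + min N.k (2 * c) ≤ N.k) (hx : s.reg 10 < 2 ^ w) :
    WP w labels s ((20 * s.reg 10 + 80) * min N.k (2 * c) + 20) (fun s' =>
      s'.reg 10 = s.reg 10 / (c + 1) ^ min N.k (2 * c) ∧
      (∀ j < min N.k (2 * c), s'.arr 13 j = s.reg 10 / (c + 1) ^ j % (c + 1)) ∧
      s'.reg 13 = N.root (s.reg 7) (fun j => s.reg 10 / (c + 1) ^ j % (c + 1))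
        (min N.k (2 * c))) := by
  have l1 : 1 % 2 ^ w = 1 := Nat.mod_eq_of_lt (by omega)
  have hW : min N.k (2 * c) ≤ N.k := min_le_left _ _
  have h5 := he.reg_W
  generalize min N.k (2 * c) = W at *
  set x := s.reg 10 with hxdef
  set lab : ℕ → ℕ := fun j => x / (c + 1) ^ j % (c + 1) with hlab
  refine WP.mono (.seq (.of_run (T := 2) rfl (by decide) (.seq (.of_run (T := 2) rfl (by decide)
    (.loop_frame (fun r s' => r = W - s'.reg 19 ∧ s'.reg 19 ≤ W ∧
      s'.reg 10 = x / (c + 1) ^ s'.reg 19 ∧ (∀ j < s'.reg 19, s'.arr 13 j = lab j) ∧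
      s'.reg 13 = N.root (s.reg 7) lab (s'.reg 19)) (20 * x + 70)
    ?_ (r := W) ?_))))) ?_ (fun _ h => h)
  · rintro r s' hf ⟨rfl, h19, h10, h13, hroot⟩
    have e7 : s'.reg 7 = s.reg 7 := hf.1 7 (by decide)
    have e5 : s'.reg 5 = W := (hf.1 5 (by decide)).trans h5
    have e6 : s'.reg 6 = c + 1 := (hf.1 6 (by decide)).trans he.reg_b
    have e9 : s'.arr 9 = N.term := (hf.2 9 (by decide)).trans he.term
    have hx' : s'.reg 10 ≤ x := by rw [h10]; exact Nat.div_le_self _ _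
    by_cases hlt : s'.reg 19 < W
    · right
      refine ⟨by simpa [Test.Holds, Expr.eval, e5] using hlt, ?_⟩
      refine WP.mono (.seq ((choose_spec (by omega) (by omega) (by omega)).frame.mono
        (show _ ≤ 20 * x + 20 by omega) ?_)) (T := 20 * x + 20 + 50) (by omega) (fun _ h => h)
      rintro s₁ ⟨⟨q11, q10⟩, hf₁⟩
      have f19 : s₁.reg 19 = s'.reg 19 := hf₁.1 19 (by decide)
      have f7 : s₁.reg 7 = s.reg 7 := (hf₁.1 7 (by decide)).trans e7
      have f13 : s₁.reg 13 = s'.reg 13 := hf₁.1 13 (by decide)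
      have f9 : s₁.arr 9 = N.term := (hf₁.2 9 (by decide)).trans e9
      have a13 : s₁.arr 13 = s'.arr 13 := hf₁.2 13 (by decide)
      have r11 : s₁.reg 11 = lab (s'.reg 19) := by rw [q11, h10, e6]
      have r10 : s₁.reg 10 = x / (c + 1) ^ (s'.reg 19 + 1) := by
        rw [q10, h10, e6, pow_succ, Nat.div_div_eq_div_mul]
      refine .of_run rfl (by decide) ⟨W - (s'.reg 19 + 1), by omega, ?_⟩
      have m1 : (s'.reg 19 + 1) % 2 ^ w = s'.reg 19 + 1 := Nat.mod_eq_of_lt (by omega)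
      have m3 : (s.reg 7 + s'.reg 19) % 2 ^ w = s.reg 7 + s'.reg 19 := Nat.mod_eq_of_lt (by omega)
      have hupd : ∀ j < s'.reg 19 + 1,
          Function.update (s'.arr 13) (s'.reg 19) (lab (s'.reg 19)) j = lab j := by
        intro j hj
        rw [Function.update_apply]
        split_ifs with hjj
        · rw [hjj]
        · exact h13 j (by omega)
      by_cases h0 : lab (s'.reg 19) = 0
      · rw [h0] at hupd r11
        simp [Prog.run, Expr.eval, Test.Holds, l1, m1, m3, f19, f7, f9, a13, r11, r10]
        exact ⟨by omega, fun j hj => hupd j (by omega), by rw [Net.root, if_pos h0]⟩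
      · simp [Prog.run, Expr.eval, Test.Holds, l1, m1, f19, f13, a13, r11, r10, h0]
        exact ⟨by omega, fun j hj => hupd j (by omega), by rw [Net.root, if_neg h0, hroot]⟩
    · left
      have : s'.reg 19 = W := by omega
      rw [this] at h10 h13 hroot
      exact ⟨by simpa [Test.Holds, Expr.eval, e5] using hlt, h10, h13, hroot⟩
  · simp [Prog.run, Expr.eval, Net.root, hxdef]
  · have : (3 + (20 * x + 70)) * W ≤ (20 * x + 80) * W := Nat.mul_le_mul_right _ (by omega)
    simp [Test.cost, Expr.cost]
    omega

/-- The answer `1` was found. -/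
def Success (N : Net) (c : ℕ) (s : State) : Prop :=
  s.reg 15 = 1 ∧ N.Viol c {x | s.arr 3 x = 0} ∧ ∀ x, s.arr 3 x ≤ 1

/-- A bound for the time that the guess `g` takes. -/
def attemptTime (N : Net) (c g : ℕ) : ℕ :=
  20 * N.M + ((20 * g + 80) * min N.k (2 * c) + (500 * (N.M + N.k) + 20 * g + 160) * c) + 50

theorem attempt_spec {w : ℕ} {N : Net} {c : ℕ} {s : State} (hw : 2 * (N.M + N.k) + 2 < 2 ^ w)
    (he : Env N c s) (hst : s.reg 7 + min N.k (2 * c) ≤ N.k) (hs : Tidy s)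
    (h17 : s.reg 17 ≤ N.M + N.k) (h15 : s.reg 15 = 0) (hx : s.reg 8 < 2 ^ w) :
    WP w attempt s (attemptTime N c (s.reg 8)) (fun s' => Tidy s' ∧ s'.reg 17 ≤ N.M + N.k ∧
      (Success N c s' ∨ (s'.reg 15 = 0 ∧
        s'.reg 10 = s.reg 8 / (c + 1) ^ (min N.k (2 * c) + c) ∧
        ∀ i < c, N.Fails c (s.reg 7) (s.reg 8) i))) := by
  unfold attemptTime
  set g := s.reg 8 with hg
  refine WP.mono (.seq ((clearFlow_spec (by omega) he).frame.mono le_rfl ?_))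
    (T := 20 * N.M + 10 + (5 + ((20 * g + 80) * min N.k (2 * c) + 20 +
      (2 + ((3 + (500 * (N.M + N.k) + 20 * g + 150)) * c + 3))))) ?_ (fun _ h => h)
  swap
  · have : (3 + (500 * (N.M + N.k) + 20 * g + 150)) * c ≤ (500 * (N.M + N.k) + 20 * g + 160) * c :=
      Nat.mul_le_mul_right _ (by omega)
    omega
  rintro s₁ ⟨h10₁, hf₁⟩
  have he₁ := he.of_frame hf₁ (by decide) (by decide)
  refine .seq (.of_run (T := 5) rfl (by decide) ?_)
  obtain ⟨s₂, hs₂⟩ : ∃ s₂, s₂ = Prog.run w (assign 10 (var 8)) s₁ := ⟨_, rfl⟩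
  have hs₂' : s₂ = s₁.setReg 10 g := by
    rw [hs₂]
    simp [Prog.run, Expr.eval, hg, hf₁.1 8 (by decide)]
  rw [← hs₂]
  have hf₂ : Frame (assign 10 (var 8)) s₁ s₂ := by
    rw [hs₂']
    refine ⟨fun x hx => ?_, fun a _ => by simp⟩
    have : x ≠ 10 := by simpa [Prog.wregs] using hx
    simp [this]
  have he₂ := he₁.of_frame hf₂ (by decide) (by decide)
  have e7₂ : s₂.reg 7 = s.reg 7 := (hf₂.1 7 (by decide)).trans (hf₁.1 7 (by decide))
  have e10₂ : s₂.reg 10 = g := by simp [hs₂']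
  refine .seq ((labels_spec (by omega) he₂ (by rwa [e7₂]) (by rwa [e10₂])).frame.mono
    (by rw [e10₂]) ?_)
  rintro s₃ ⟨⟨h10₃, h13₃, hroot₃⟩, hf₃⟩
  have he₃ := he₂.of_frame hf₃ (by decide) (by decide)
  rw [e10₂] at h10₃ h13₃ hroot₃
  rw [e7₂] at hroot₃
  refine .seq (.of_run (T := 2) rfl (by decide) ?_)
  obtain ⟨s₄, hs₄⟩ : ∃ s₄, s₄ = Prog.run w (assign 14 (var 2)) s₃ := ⟨_, rfl⟩
  have hs₄' : s₄ = s₃.setReg 14 c := by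
    rw [hs₄]
    simp [Prog.run, Expr.eval, he₃.reg_c]
  rw [← hs₄]
  have hf₄ : Frame (assign 14 (var 2)) s₃ s₄ := by
    rw [hs₄']
    refine ⟨fun x hx => ?_, fun a _ => by simp⟩
    have : x ≠ 14 := by simpa [Prog.wregs] using hx
    simp [this]
  have he₄ := he₃.of_frame hf₄ (by decide) (by decide)
  have r (x) (h₁ : x ∉ clearFlow.wregs) (h₂ : x ∉ (assign 10 (var 8)).wregs)
      (h₃ : x ∉ labels.wregs) (h₄ : x ∉ (assign 14 (var 2)).wregs) : s₄.reg x = s.reg x := by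
    rw [hf₄.1 x h₄, hf₃.1 x h₃, hf₂.1 x h₂, hf₁.1 x h₁]
  have a (x) (h₁ : x ∉ clearFlow.warrs) (h₂ : x ∉ (assign 10 (var 8)).warrs)
      (h₃ : x ∉ labels.warrs) (h₄ : x ∉ (assign 14 (var 2)).warrs) : s₄.arr x = s.arr x := by
    rw [hf₄.2 x h₄, hf₃.2 x h₃, hf₂.2 x h₂, hf₁.2 x h₁]
  have e7 : s₄.reg 7 = s.reg 7 := r 7 (by decide) (by decide) (by decide) (by decide)
  have e15 : s₄.reg 15 = 0 := (r 15 (by decide) (by decide) (by decide) (by decide)).trans h15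
  have e17 : s₄.reg 17 = s.reg 17 := r 17 (by decide) (by decide) (by decide) (by decide)
  have e10 : s₄.reg 10 = g / (c + 1) ^ min N.k (2 * c) := by simp [hs₄', h10₃]
  have e14 : s₄.reg 14 = c := by simp [hs₄']
  have e13 : s₄.reg 13 = s₃.reg 13 := by simp [hs₄']
  have f13 : s₄.arr 13 = s₃.arr 13 := by simp [hs₄']
  have f10 : ∀ h < N.M, s₄.arr 10 h = 0 := by
    rw [hf₄.2 10 (by decide), hf₃.2 10 (by decide), hf₂.2 10 (by decide)]
    exact h10₁
  have htidy : Tidy s₄ := by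
    unfold Tidy
    rw [e17, a 3 (by decide) (by decide) (by decide) (by decide),
      a 12 (by decide) (by decide) (by decide) (by decide),
      a 11 (by decide) (by decide) (by decide) (by decide)]
    exact hs
  clear_value g
  have hT : N.sinks (s.reg 7) (min N.k (2 * c)) (fun j => g / (c + 1) ^ j % (c + 1)) =
      N.sinks (s.reg 7) (min N.k (2 * c)) (s₄.arr 13) :=
    N.sinks_congr _ fun j hj => by rw [f13, h13₃ j hj]
  have hfails (i) : N.Fails c (s.reg 7) g i ↔
      N.cut (N.satur (N.sinks (s.reg 7) (min N.k (2 * c)) (s₄.arr 13)) (N.srcs (N.sinks (s.reg 7)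
        (min N.k (2 * c)) (s₄.arr 13)) (s₄.reg 13)
        (fun i => g / (c + 1) ^ (min N.k (2 * c) + i) % (c + 1)) i)) ≤
        mult (N.srcs (N.sinks (s.reg 7)
        (min N.k (2 * c)) (s₄.arr 13)) (s₄.reg 13)
        (fun i => g / (c + 1) ^ (min N.k (2 * c) + i) % (c + 1)) i)
        (N.satur (N.sinks (s.reg 7) (min N.k (2 * c)) (s₄.arr 13)) (N.srcs (N.sinks (s.reg 7)
        (min N.k (2 * c)) (s₄.arr 13)) (s₄.reg 13)
        (fun i => g / (c + 1) ^ (min N.k (2 * c) + i) % (c + 1)) i)) ∧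
      ¬ N.Viol c (N.satur (N.sinks (s.reg 7) (min N.k (2 * c)) (s₄.arr 13)) (N.srcs (N.sinks (s.reg 7)
        (min N.k (2 * c)) (s₄.arr 13)) (s₄.reg 13)
        (fun i => g / (c + 1) ^ (min N.k (2 * c) + i) % (c + 1)) i)) := by
    unfold Net.Fails
    rw [hT, ← hroot₃, ← e13]
  generalize hTdef : N.sinks (s.reg 7) (min N.k (2 * c)) (s₄.arr 13) = T at hfails
  clear hT
  refine WP.mono (.loop_frame (fun r s' => Tidy s' ∧ s'.reg 17 ≤ N.M + N.k ∧
    ((s'.reg 14 = 0 ∧ Success N c s') ∨ (s'.reg 15 = 0 ∧ s'.reg 14 = r ∧ r ≤ c ∧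
      s'.reg 10 = g / (c + 1) ^ (min N.k (2 * c) + (c - r)) ∧
      (∀ i < c - r, N.Fails c (s.reg 7) g i) ∧
      N.IsFlow T (N.srcs T (s₄.reg 13) (fun i => g / (c + 1) ^ (min N.k (2 * c) + i) % (c + 1))
        (c - r)) (s'.arr 10))))
    (500 * (N.M + N.k) + 20 * g + 150) ?_ (r := c) ?_) ?_ (fun _ h => h)
  · rintro r s' hf ⟨ht', h17', h⟩
    rcases h with ⟨h14, hsucc⟩ | ⟨h15', h14, hrc, h10', hfail, hflow⟩
    · exact Or.inl ⟨by simp [Test.Holds, Expr.eval, h14], ht', h17', Or.inl hsucc⟩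
    · by_cases hr : r = 0
      · subst hr
        exact Or.inl ⟨by simp [Test.Holds, Expr.eval, h14], ht', h17', Or.inr ⟨h15', h10', hfail⟩⟩
      · right
        refine ⟨by simp [Test.Holds, Expr.eval, h14]; omega, ?_⟩
        have he' := he₄.of_frame hf (by decide) (by decide)
        have q7 : s'.reg 7 = s.reg 7 := (hf.1 7 (by decide)).trans e7
        have q13 : s'.reg 13 = s₄.reg 13 := hf.1 13 (by decide)
        have qa13 : s'.arr 13 = s₄.arr 13 := hf.2 13 (by decide)
        have hle : s'.reg 10 ≤ g := by rw [h10']; exact Nat.div_le_self _ _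
        refine (round_spec hw he' (by rwa [q7]) ht' h17' h15' (by omega) (T := T)
          (by rw [q7, qa13, hTdef]) hflow).mono (by omega) ?_
        rintro s'' ⟨ht'', h17'', h⟩
        refine ⟨r - 1, by omega, ht'', h17'', ?_⟩
        rcases h with ⟨k1, k2, k3, k4⟩ | ⟨k1, k2, k3, k4, k5, k6⟩
        · exact Or.inl ⟨k2, k1, k3, k4⟩
        · have hcr : c - (r - 1) = c - r + 1 := by omega
          refine Or.inr ⟨k1, by omega, by omega, ?_, ?_, ?_⟩
          · rw [k3, h10', hcr, Nat.div_div_eq_div_mul, ← pow_succ, add_assoc]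
          · intro i hi
            rcases Nat.lt_or_eq_of_le (show i ≤ c - r by omega) with h | rfl
            · exact hfail i h
            · exact (hfails _).2 ⟨k4, k5⟩
          · rw [hcr, Net.srcs]
            rwa [q13, h10'] at k6
  · refine ⟨htidy, by omega, Or.inr ⟨e15, e14, le_rfl, ?_, ?_, ?_⟩⟩
    · simpa using e10
    · intro i hi
      omega
    · rw [Nat.sub_self, Net.srcs]
      refine ⟨⟨fun h hh => by rw [f10 h hh]; omega, fun h hh h1 => ?_⟩, fun U _ => ?_⟩
      · rw [f10 h hh] at h1
        omega
      · have : mult [] U = 0 := by simp [mult]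
        rw [this, Net.net]
        refine Finset.sum_eq_zero fun h hh => ?_
        rw [f10 h (Finset.mem_range.1 hh)]
        simp
  · simp [Test.cost, Expr.cost]

theorem attemptTime_mono (N : Net) (c : ℕ) {g g' : ℕ} (h : g ≤ g') :
    attemptTime N c g ≤ attemptTime N c g' := by
  unfold attemptTime
  gcongr

theorem guesses_spec {w : ℕ} {N : Net} {c : ℕ} {s : State}
    (hw : 2 * (N.M + N.k) + 2 < 2 ^ w)
    (hB : (c + 1) ^ (min N.k (2 * c) + c) + 1 < 2 ^ w)
    (he : Env N c s) (hst : s.reg 7 + min N.k (2 * c) ≤ N.k) (hs : Tidy s)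
    (h17 : s.reg 17 ≤ N.M + N.k) (h15 : s.reg 15 = 0) :
    WP w guesses s ((attemptTime N c ((c + 1) ^ (min N.k (2 * c) + c)) + 50) *
        ((c + 1) ^ (min N.k (2 * c) + c) + 1) + 20)
      (fun s' => Tidy s' ∧ s'.reg 17 ≤ N.M + N.k ∧ (Success N c s' ∨ (s'.reg 15 = 0 ∧
        ∀ g < (c + 1) ^ (min N.k (2 * c) + c), ∀ i < c, N.Fails c (s.reg 7) g i))) := by
  have l1 : 1 % 2 ^ w = 1 := Nat.mod_eq_of_lt (by omega)
  set B := (c + 1) ^ (min N.k (2 * c) + c) with hBdef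
  have hBpos : 0 < B := by positivity
  refine WP.mono (.seq (.of_run (T := 2) rfl (by decide) (.seq (.of_run (T := 2) rfl (by decide)
    (.loop_frame (fun r s' => Tidy s' ∧ s'.reg 17 ≤ N.M + N.k ∧
      ((s'.reg 9 = 0 ∧ Success N c s') ∨ (s'.reg 9 = 0 ∧ s'.reg 15 = 0 ∧
        ∀ g < B, ∀ i < c, N.Fails c (s.reg 7) g i) ∨
      (s'.reg 9 = 1 ∧ s'.reg 15 = 0 ∧ s'.reg 8 ≤ B ∧ r = B + 1 - s'.reg 8 ∧
        ∀ g < s'.reg 8, ∀ i < c, N.Fails c (s.reg 7) g i)))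
      (attemptTime N c B + 40) ?_ (r := B + 1) ?_))))) ?_ (fun _ h => h)
  · rintro r s' hf ⟨ht', h17', h⟩
    rcases h with ⟨h9, hsucc⟩ | ⟨h9, h15', hfail⟩ | ⟨h9, h15', h8, hr, hfail⟩
    · exact Or.inl ⟨by simp [Test.Holds, Expr.eval, h9], ht', h17', Or.inl hsucc⟩
    · exact Or.inl ⟨by simp [Test.Holds, Expr.eval, h9], ht', h17', Or.inr ⟨h15', hfail⟩⟩
    · right
      refine ⟨by simp [Test.Holds, Expr.eval, h9], ?_⟩
      have he₀ : Env N c (Prog.run w (assign 9 (lit 1)) (Prog.run w (assign 8 (lit 0)) s)) := by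
        constructor
        · constructor <;> simp [Prog.run, he.reg_c, he.reg_M, he.reg_k, he.tail, he.head, he.rev,
            he.term, he.first]
          exact he.next
        · simp [Prog.run, he.reg_W]
        · simp [Prog.run, he.reg_b]
      have he' := he₀.of_frame hf (by decide) (by decide)
      have q7 : s'.reg 7 = s.reg 7 := by
        rw [hf.1 7 (by decide)]
        simp [Prog.run]
      refine WP.seq ((attempt_spec hw he' (by rwa [q7]) ht' h17' h15' (by omega)).frame.mono
        (attemptTime_mono N c h8) ?_)
      rintro s₁ ⟨⟨ht₁, h17₁, h⟩, hf₁⟩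
      have e8 : s₁.reg 8 = s'.reg 8 := hf₁.1 8 (by decide)
      have e9 : s₁.reg 9 = 1 := (hf₁.1 9 (by decide)).trans h9
      refine .of_run rfl (by decide) ?_
      rcases h with hsucc | ⟨k15, k10, kfail⟩
      · refine ⟨0, by omega, ?_⟩
        have hrun : Prog.run w (.ite (.eq (var 15) (lit 1)) (assign 9 (lit 0))
            (.ite (.eq (var 10) (lit 0)) (assign 8 (add (var 8) (lit 1))) (assign 9 (lit 0)))) s₁ =
            s₁.setReg 9 0 := by
          simp [Prog.run, Test.Holds, Expr.eval, l1, hsucc.1]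
        rw [hrun]
        refine ⟨?_, by simpa using h17₁, Or.inl ⟨by simp, ?_⟩⟩
        · simpa [Tidy] using ht₁
        · simpa [Success] using hsucc
      · rw [q7] at kfail
        by_cases h0 : s'.reg 8 < B
        · have k10' : s₁.reg 10 = 0 := by rw [k10, Nat.div_eq_of_lt h0]
          have m1 : (s'.reg 8 + 1) % 2 ^ w = s'.reg 8 + 1 := Nat.mod_eq_of_lt (by omega)
          have hrun : Prog.run w (.ite (.eq (var 15) (lit 1)) (assign 9 (lit 0))
              (.ite (.eq (var 10) (lit 0)) (assign 8 (add (var 8) (lit 1)))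
                (assign 9 (lit 0)))) s₁ = s₁.setReg 8 (s'.reg 8 + 1) := by
            simp [Prog.run, Test.Holds, Expr.eval, l1, k15, k10', e8, m1]
          rw [hrun]
          refine ⟨B + 1 - (s'.reg 8 + 1), by omega, ?_, by simpa using h17₁, Or.inr (Or.inr ?_)⟩
          · simpa [Tidy] using ht₁
          · simp [e9, k15]
            refine ⟨by omega, fun g hg => ?_⟩
            rcases Nat.lt_or_eq_of_le hg with h | rfl
            · exact hfail g (by omega)
            · exact kfail
        · have h8' : s'.reg 8 = B := by omega
          have k10' : s₁.reg 10 ≠ 0 := by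
            rw [k10, h8', Nat.div_self hBpos]
            omega
          have hrun : Prog.run w (.ite (.eq (var 15) (lit 1)) (assign 9 (lit 0))
              (.ite (.eq (var 10) (lit 0)) (assign 8 (add (var 8) (lit 1)))
                (assign 9 (lit 0)))) s₁ = s₁.setReg 9 0 := by
            simp [Prog.run, Test.Holds, Expr.eval, l1, k15, k10']
          rw [hrun]
          rw [h8'] at hfail
          refine ⟨0, by omega, ?_, by simpa using h17₁, Or.inr (Or.inl ⟨by simp, by simp [k15], hfail⟩)⟩
          simpa [Tidy] using ht₁
  · simp [Prog.run, Expr.eval, l1, h15, h17]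
    simpa [Tidy] using hs
  · have : (3 + (attemptTime N c B + 40)) * (B + 1) ≤ (attemptTime N c B + 50) * (B + 1) :=
      Nat.mul_le_mul_right _ (by omega)
    simp [Test.cost, Expr.cost]
    omega

end ViolatingCut

namespace ViolatingCut

open WordRAM Prog Expr Test

theorem windows_spec {w : ℕ} {N : Net} {c : ℕ} {s : State}
    (hw : 2 * (N.M + N.k) + 2 * c + 2 < 2 ^ w)
    (hB : (c + 1) ^ (min N.k (2 * c) + c) + 1 < 2 ^ w)
    (he : Holds N c s) (h3 : ∀ x, s.arr 3 x = 0) (h12 : ∀ x, s.arr 12 x = 0)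
    (h17 : s.reg 17 = 0) (h15 : s.reg 15 = 0) :
    WP w windows s (((attemptTime N c ((c + 1) ^ (min N.k (2 * c) + c)) + 50) *
        ((c + 1) ^ (min N.k (2 * c) + c) + 1) + 50) * (N.k + 1) + 30)
      (fun s' => Success N c s' ∨ (s'.reg 15 = 0 ∧ ∀ A, ¬ N.Viol c A)) := by
  have l1 : 1 % 2 ^ w = 1 := Nat.mod_eq_of_lt (by omega)
  have m1 : (c + c) % 2 ^ w = c + c := Nat.mod_eq_of_lt (by omega)
  have m2 : (c + 1) % 2 ^ w = c + 1 := Nat.mod_eq_of_lt (by omega)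
  have m3 : (N.k - min N.k (2 * c) + 1) % 2 ^ w = N.k - min N.k (2 * c) + 1 :=
    Nat.mod_eq_of_lt (by omega)
  set tm := (attemptTime N c ((c + 1) ^ (min N.k (2 * c) + c)) + 50) *
        ((c + 1) ^ (min N.k (2 * c) + c) + 1) with htm
  set W := min N.k (2 * c) with hW
  have hWk : W ≤ N.k := min_le_left _ _
  obtain ⟨s₁, hs₁⟩ : ∃ s₁, s₁ = Prog.run w (.ite (.lt (var 4) (add (var 2) (var 2)))
    (assign 5 (var 4)) (assign 5 (add (var 2) (var 2)))) s := ⟨_, rfl⟩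
  have hs₁' : s₁ = s.setReg 5 W := by
    rw [hs₁]
    by_cases hlt : N.k < c + c
    · simp [Prog.run, Test.Holds, Expr.eval, he.reg_c, he.reg_k, m1, hlt]
      rw [hW, min_eq_left (by omega)]
    · simp [Prog.run, Test.Holds, Expr.eval, he.reg_c, he.reg_k, m1, hlt]
      rw [hW, min_eq_right (by omega), two_mul]
  obtain ⟨s₃, hs₃⟩ : ∃ s₃, s₃ = Prog.run w (assign 7 (add (sub (var 4) (var 5)) (lit 1)))
    (Prog.run w (assign 6 (add (var 2) (lit 1))) s₁) := ⟨_, rfl⟩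
  have hs₃' : s₃ = ((s.setReg 5 W).setReg 6 (c + 1)).setReg 7 (N.k - W + 1) := by
    rw [hs₃, hs₁']
    simp [Prog.run, Expr.eval, he.reg_c, he.reg_k, l1, m2, m3]
  have he₃ : Env N c s₃ := by
    rw [hs₃']
    constructor
    · constructor <;> simp [he.reg_c, he.reg_M, he.reg_k, he.tail, he.head, he.rev,
        he.term, he.first]
      exact he.next
    · simp [hW]
    · simp
  refine WP.mono (.seq (.of_run (T := 12) rfl (by decide) ?_))
    (T := 12 + (4 + (6 + ((3 + (tm + 40)) * (N.k - W + 1) + 3)))) ?_ (fun _ h => h)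
  swap
  · have : (3 + (tm + 40)) * (N.k - W + 1) ≤ (tm + 50) * (N.k + 1) :=
      Nat.mul_le_mul (by omega) (by omega)
    omega
  rw [← hs₁]
  refine .seq (.of_run rfl (by decide) (.seq (.of_run rfl (by decide) ?_)))
  rw [← hs₃]
  refine WP.loop_frame (fun r s' => Tidy s' ∧ s'.reg 17 ≤ N.M + N.k ∧
      ((s'.reg 7 = 0 ∧ Success N c s') ∨ (s'.reg 15 = 0 ∧ s'.reg 7 = r ∧ r ≤ N.k - W + 1 ∧
        ∀ st, r ≤ st → st + W ≤ N.k → ∀ g < (c + 1) ^ (W + c), ∀ i < c, N.Fails c st g i)))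
      (tm + 40) ?_ (r := N.k - W + 1) ?_
  · rintro r s' hf ⟨ht', h17', h⟩
    rcases h with ⟨h7, hsucc⟩ | ⟨h15', h7, hr, hfail⟩
    · exact Or.inl ⟨by simp [Test.Holds, Expr.eval, h7], Or.inl hsucc⟩
    · by_cases hr0 : r = 0
      · subst hr0
        refine Or.inl ⟨by simp [Test.Holds, Expr.eval, h7], Or.inr ⟨h15', ?_⟩⟩
        exact N.not_viol_of_fails fun st => hfail st (Nat.zero_le _)
      · right
        refine ⟨by simp [Test.Holds, Expr.eval, h7]; omega, ?_⟩
        have he' := he₃.of_frame hf (by decide) (by decide)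
        have hrun : Prog.run w (assign 7 (sub (var 7) (lit 1))) s' = s'.setReg 7 (r - 1) := by
          simp [Prog.run, Expr.eval, l1, h7]
        refine WP.mono (.seq (.of_run (T := 4) rfl (by decide) ?_)) (T := 4 + (tm + 20 + 10))
          (by omega) (fun _ h => h)
        rw [hrun]
        have he₄ : Env N c (s'.setReg 7 (r - 1)) := by
          constructor
          · constructor <;> simp [he'.reg_c, he'.reg_M, he'.reg_k, he'.tail, he'.head, he'.rev,
              he'.term, he'.first]
            exact he'.next
          · simp [he'.reg_W]
          · simp [he'.reg_b]
        refine WP.seq ((guesses_spec (by omega) hB he₄ ?_ ?_ ?_ ?_).frame.mono le_rfl ?_)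
        · simp only [State.setReg_reg, if_true]
          omega
        · simpa [Tidy] using ht'
        · simpa using h17'
        · simpa using h15'
        · rintro s₅ ⟨⟨ht₅, h17₅, h⟩, hf₅⟩
          have q7 : s₅.reg 7 = r - 1 := by rw [hf₅.1 7 (by decide)]; simp
          refine .of_run rfl (by decide) ?_
          rcases h with hsucc | ⟨k15, kfail⟩
          · have hrun₅ : Prog.run w (.ite (.eq (var 15) (lit 1)) (assign 7 (lit 0)) .skip) s₅ =
                s₅.setReg 7 0 := by
              simp [Prog.run, Test.Holds, Expr.eval, l1, hsucc.1]
            rw [hrun₅]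
            refine ⟨0, by omega, ?_, by simpa using h17₅, Or.inl ⟨by simp, ?_⟩⟩
            · simpa [Tidy] using ht₅
            · simpa [Success] using hsucc
          · have hrun₅ : Prog.run w (.ite (.eq (var 15) (lit 1)) (assign 7 (lit 0)) .skip) s₅ =
                s₅ := by
              simp [Prog.run, Test.Holds, Expr.eval, l1, k15]
            rw [hrun₅]
            refine ⟨r - 1, by omega, ht₅, h17₅, Or.inr ⟨k15, q7, by omega, ?_⟩⟩
            intro st hst hstk
            rcases Nat.lt_or_eq_of_le hst with h | rfl
            · exact hfail st (by omega) hstk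
            · simpa using kfail
  · refine ⟨?_, ?_, Or.inr ⟨?_, ?_, le_rfl, ?_⟩⟩
    · intro x hx
      simp [hs₃', h3, h12] at hx
    · simp [hs₃', h17]
    · simp [hs₃', h15]
    · simp [hs₃']
    · intro st hst hstk
      omega

/-! ### Building the network -/

/-- `first` and `next` link the arcs with the same head. -/
def Linked (head first next : ℕ → ℕ) (M : ℕ) : Prop :=
  (∀ v, first v = Net.last head v M) ∧ ∀ h < M, next h = Net.last head (head h) h

theorem Linked.push {head first next : ℕ → ℕ} {M : ℕ} (h : Linked head first next M) (v : ℕ) :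
    Linked (Function.update head M v) (Function.update first v (M + 1))
      (Function.update next M (first v)) (M + 1) := by
  have hlast (x : ℕ) (n : ℕ) (hn : n ≤ M) :
      Net.last (Function.update head M v) x n = Net.last head x n :=
    Net.last_congr fun i hi => Function.update_of_ne (by omega) _ _
  refine ⟨fun x => ?_, fun g hg => ?_⟩
  · rw [Net.last, hlast x M le_rfl, Function.update_self, Function.update_apply]
    by_cases hx : x = v
    · simp [hx]
    · simp [hx, Ne.symm hx, h.1]
  · rw [hlast _ g (by omega)]
    rcases Nat.lt_succ_iff_lt_or_eq.1 hg with hg' | rfl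
    · rw [Function.update_of_ne (by omega), Function.update_of_ne (by omega), h.2 g hg']
    · simp [h.1]

/-- The edge `e` with ends `a e` and `b e` joins `X ∩ A` to `X \ A`. -/
def Crosses (a b : ℕ → ℕ) (X A : Set ℕ) (e : ℕ) : Prop :=
  a e ∈ X ∧ b e ∈ X ∧ ((a e ∈ A ∧ b e ∉ A) ∨ (b e ∈ A ∧ a e ∉ A))

/-- The edge `e` with ends `a e` and `b e` joins `X ∩ A` to the complement of `X`. -/
def Leaves (a b : ℕ → ℕ) (X A : Set ℕ) (e : ℕ) : Prop :=
  (a e ∈ X ∧ b e ∉ X ∧ a e ∈ A) ∨ (b e ∈ X ∧ a e ∉ X ∧ b e ∈ A)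

/-- The part of the network that the edges `0, …, e - 1` contribute. -/
structure Built (a b : ℕ → ℕ) (X : Set ℕ) (e M k : ℕ) (tail head rev first next term : ℕ → ℕ) :
    Prop where
  M_le : M ≤ 2 * e
  k_le : k ≤ e
  rev_lt : ∀ h < M, rev h < M
  tail_rev : ∀ h < M, tail (rev h) = head h
  head_rev : ∀ h < M, head (rev h) = tail h
  rev_rev : ∀ h < M, rev (rev h) = h
  ne : ∀ h < M, tail h ≠ head h
  linked : Linked head first next M
  cut_eq : ∀ A : Set ℕ, cnt (fun h => tail h ∈ A ∧ head h ∉ A) M = cnt (Crosses a b X A) e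
  dem_eq : ∀ A : Set ℕ, cnt (fun j => term j ∈ A) k = cnt (Leaves a b X A) e

section

variable {a b : ℕ → ℕ} {X : Set ℕ} {e M k : ℕ} {tail head rev first next term : ℕ → ℕ}

theorem Built.skip (h : Built a b X e M k tail head rev first next term)
    (he : (a e ∉ X ∧ b e ∉ X) ∨ (a e ∈ X ∧ b e ∈ X ∧ a e = b e)) :
    Built a b X (e + 1) M k tail head rev first next term := by
  refine ⟨by have := h.M_le; omega, by have := h.k_le; omega, h.rev_lt, h.tail_rev, h.head_rev,
    h.rev_rev, h.ne, h.linked, fun A => ?_, fun A => ?_⟩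
  · rw [cnt_succ_of_neg, h.cut_eq]
    rintro ⟨h1, h2, h3⟩
    rcases he with he | ⟨-, -, he⟩
    · exact he.1 h1
    · rw [he] at h3
      tauto
  · rw [cnt_succ_of_neg, h.dem_eq]
    unfold Leaves
    tauto

theorem Built.push_term (h : Built a b X e M k tail head rev first next term) {u : ℕ}
    (he : (a e ∈ X ∧ b e ∉ X ∧ u = a e) ∨ (b e ∈ X ∧ a e ∉ X ∧ u = b e)) :
    Built a b X (e + 1) M (k + 1) tail head rev first next (Function.update term k u) := by
  refine ⟨by have := h.M_le; omega, by have := h.k_le; omega, h.rev_lt, h.tail_rev, h.head_rev,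
    h.rev_rev, h.ne, h.linked, fun A => ?_, fun A => ?_⟩
  · rw [cnt_succ_of_neg, h.cut_eq]
    unfold Crosses
    tauto
  · have h1 : cnt (fun j => Function.update term k u j ∈ A) k = cnt (fun j => term j ∈ A) k :=
      cnt_congr fun j hj => by rw [Function.update_of_ne (by omega)]
    have h2 : u ∈ A ↔ Leaves a b X A e := by
      unfold Leaves
      rcases he with ⟨h1, h2, rfl⟩ | ⟨h1, h2, rfl⟩ <;> tauto
    have h3 : Function.update term k u k ∈ A ↔ u ∈ A := by rw [Function.update_self]
    by_cases hu : u ∈ A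
    · rw [cnt_succ_of_pos (p := fun j => Function.update term k u j ∈ A) (h3.2 hu), cnt_succ_of_pos (h2.1 hu), h1, h.dem_eq]
    · rw [cnt_succ_of_neg (p := fun j => Function.update term k u j ∈ A) (fun h => hu (h3.1 h)),
        cnt_succ_of_neg (fun h => hu (h2.2 h)), h1, h.dem_eq]

theorem Built.push_edge (h : Built a b X e M k tail head rev first next term)
    (ha : a e ∈ X) (hb : b e ∈ X) (hab : a e ≠ b e) :
    Built a b X (e + 1) (M + 1 + 1) k
      (Function.update (Function.update tail M (a e)) (M + 1) (b e))
      (Function.update (Function.update head M (b e)) (M + 1) (a e))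
      (Function.update (Function.update rev M (M + 1)) (M + 1) M)
      (Function.update (Function.update first (b e) (M + 1)) (a e) (M + 1 + 1))
      (Function.update (Function.update next M (first (b e))) (M + 1)
        (Function.update first (b e) (M + 1) (a e))) term := by
  set tail' := Function.update (Function.update tail M (a e)) (M + 1) (b e) with ht
  set head' := Function.update (Function.update head M (b e)) (M + 1) (a e) with hh
  set rev' := Function.update (Function.update rev M (M + 1)) (M + 1) M with hr
  have t (i) (hi : i < M) : tail' i = tail i := by
    rw [ht, Function.update_of_ne (by omega), Function.update_of_ne (by omega)]
  have d (i) (hi : i < M) : head' i = head i := by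
    rw [hh, Function.update_of_ne (by omega), Function.update_of_ne (by omega)]
  have r (i) (hi : i < M) : rev' i = rev i := by
    rw [hr, Function.update_of_ne (by omega), Function.update_of_ne (by omega)]
  have t0 : tail' M = a e := by simp [ht]
  have t1 : tail' (M + 1) = b e := by simp [ht]
  have d0 : head' M = b e := by simp [hh]
  have d1 : head' (M + 1) = a e := by simp [hh]
  have r0 : rev' M = M + 1 := by simp [hr]
  have r1 : rev' (M + 1) = M := by simp [hr]
  have cases (P : ℕ → Prop) (h0 : ∀ i < M, P i) (h1 : P M) (h2 : P (M + 1)) :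
      ∀ i < M + 1 + 1, P i := by
    intro i hi
    rcases Nat.lt_succ_iff_lt_or_eq.1 hi with hi | rfl
    · rcases Nat.lt_succ_iff_lt_or_eq.1 hi with hi | rfl
      · exact h0 i hi
      · exact h1
    · exact h2
  refine ⟨by have := h.M_le; omega, by have := h.k_le; omega, cases _ ?_ ?_ ?_, cases _ ?_ ?_ ?_,
    cases _ ?_ ?_ ?_, cases _ ?_ ?_ ?_, cases _ ?_ ?_ ?_, (h.linked.push _).push _, fun A => ?_,
    fun A => ?_⟩
  · intro i hi
    have := h.rev_lt i hi
    rw [r i hi]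
    omega
  · omega
  · omega
  · intro i hi
    rw [r i hi, t _ (h.rev_lt i hi), d i hi, h.tail_rev i hi]
  · rw [r0, t1, d0]
  · rw [r1, t0, d1]
  · intro i hi
    rw [r i hi, d _ (h.rev_lt i hi), t i hi, h.head_rev i hi]
  · rw [r0, d1, t0]
  · rw [r1, d0, t1]
  · intro i hi
    rw [r i hi, r _ (h.rev_lt i hi), h.rev_rev i hi]
  · rw [r0, r1]
  · rw [r1, r0]
  · intro i hi
    rw [t i hi, d i hi]
    exact h.ne i hi
  · rw [t0, d0]
    exact hab
  · rw [t1, d1]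
    exact hab.symm
  · have h1 : cnt (fun h => tail' h ∈ A ∧ head' h ∉ A) M =
        cnt (fun h => tail h ∈ A ∧ head h ∉ A) M :=
      cnt_congr fun j hj => by rw [t j hj, d j hj]
    rw [cnt_succ, cnt_succ, cnt_succ, h1, h.cut_eq, t0, t1, d0, d1]
    unfold Crosses
    by_cases h2 : a e ∈ A <;> by_cases h3 : b e ∈ A <;> simp [ha, hb, h2, h3]
  · rw [cnt_succ_of_neg, h.dem_eq]
    unfold Leaves
    tauto

end

/-- The network of a finished construction. -/
def Built.toNet {a b : ℕ → ℕ} {X : Set ℕ} {e M k : ℕ} {tail head rev first next term : ℕ → ℕ}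
    (h : Built a b X e M k tail head rev first next term) : Net :=
  ⟨M, k, tail, head, rev, term, h.rev_lt, h.tail_rev, h.head_rev, h.rev_rev, h.ne⟩

theorem prepare_spec {w n m c : ℕ} {G : Graph ℕ ℕ} {X : Set ℕ} {s : State}
    (hI : IsInput n m c G X s) (hw : 4 * m + 4 < 2 ^ w) :
    WP w prepare s (120 * m + 10) (fun s' => ∃ N : Net, Holds N c s' ∧ N.M ≤ 2 * m ∧ N.k ≤ m ∧
      (∀ A, N.cut A = cnt (Crosses (s.arr 0) (s.arr 1) X A) m) ∧
      ∀ A, N.dem A = cnt (Leaves (s.arr 0) (s.arr 1) X A) m) := by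
  have l1 : 1 % 2 ^ w = 1 := Nat.mod_eq_of_lt (by omega)
  have hX (v) : s.arr 2 v = 1 ↔ v ∈ X := by
    refine ⟨fun h => ?_, hI.mem v⟩
    by_contra hv
    rw [hI.notMem v hv] at h
    omega
  refine WP.mono (.loop_frame (fun r s' => r = m - s'.reg 19 ∧ s'.reg 19 ≤ m ∧
    Built (s.arr 0) (s.arr 1) X (s'.reg 19) (s'.reg 3) (s'.reg 4) (s'.arr 4) (s'.arr 5) (s'.arr 6)
      (s'.arr 7) (s'.arr 8) (s'.arr 9)) 110 ?_ (r := m) ?_) ?_ (fun _ h => h)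
  · rintro r s' hf ⟨rfl, h19, hB⟩
    have e0 : s'.arr 0 = s.arr 0 := hf.2 0 (by decide)
    have e1 : s'.arr 1 = s.arr 1 := hf.2 1 (by decide)
    have e2 (v) : s'.arr 2 v = 1 ↔ v ∈ X := by rw [hf.2 2 (by decide)]; exact hX v
    have em : s'.reg 1 = m := (hf.1 1 (by decide)).trans hI.reg_one
    have hM := hB.M_le
    have hk := hB.k_le
    by_cases hlt : s'.reg 19 < m
    · right
      refine ⟨by simpa [Test.Holds, Expr.eval, em] using hlt, .of_run rfl (by decide) ?_⟩
      refine ⟨m - (s'.reg 19 + 1), by omega, ?_⟩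
      have m1 : (s'.reg 19 + 1) % 2 ^ w = s'.reg 19 + 1 := Nat.mod_eq_of_lt (by omega)
      have m2 : (s'.reg 3 + 1) % 2 ^ w = s'.reg 3 + 1 := Nat.mod_eq_of_lt (by omega)
      have m3 : (s'.reg 3 + 1 + 1) % 2 ^ w = s'.reg 3 + 1 + 1 := Nat.mod_eq_of_lt (by omega)
      have m4 : (s'.reg 4 + 1) % 2 ^ w = s'.reg 4 + 1 := Nat.mod_eq_of_lt (by omega)
      by_cases ha : s.arr 0 (s'.reg 19) ∈ X
      · by_cases hb : s.arr 1 (s'.reg 19) ∈ X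
        · by_cases hab : s.arr 0 (s'.reg 19) = s.arr 1 (s'.reg 19)
          · rw [hab] at ha
            simp [Prog.run, Expr.eval, Test.Holds, l1, m1, e0, e1, e2, hb, hab]
            exact ⟨by omega, hB.skip (Or.inr ⟨hab ▸ hb, hb, hab⟩)⟩
          · simp [Prog.run, Expr.eval, Test.Holds, l1, m1, m2, m3, e0, e1, e2, ha, hb, hab, addArc]
            have h := hB.push_edge ha hb hab
            rw [Function.update_of_ne (f := s'.arr 7) hab] at h
            exact ⟨by omega, h⟩
        · simp [Prog.run, Expr.eval, Test.Holds, l1, m1, m4, e0, e1, e2, ha, hb]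
          exact ⟨by omega, hB.push_term (Or.inl ⟨ha, hb, rfl⟩)⟩
      · by_cases hb : s.arr 1 (s'.reg 19) ∈ X
        · simp [Prog.run, Expr.eval, Test.Holds, l1, m1, m4, e0, e1, e2, ha, hb]
          exact ⟨by omega, hB.push_term (Or.inr ⟨hb, ha, rfl⟩)⟩
        · simp [Prog.run, Expr.eval, Test.Holds, l1, m1, e0, e1, e2, ha, hb]
          exact ⟨by omega, hB.skip (Or.inl ⟨ha, hb⟩)⟩
    · left
      have h19' : s'.reg 19 = m := by omega
      rw [h19'] at hB hM hk
      refine ⟨by simpa [Test.Holds, Expr.eval, em] using hlt, hB.toNet, ?_, hM, hk, hB.cut_eq,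
        hB.dem_eq⟩
      exact ⟨(hf.1 2 (by decide)).trans hI.reg_two, rfl, rfl, rfl, rfl, rfl, rfl, hB.linked.1,
        hB.linked.2⟩
  · have z (x) (hx : 3 ≤ x) := hI.reg_rest x hx
    rw [z 19 (by omega), z 3 (by omega), z 4 (by omega)]
    refine ⟨rfl, by omega, le_rfl, le_rfl, by omega, by omega, by omega, by omega, by omega,
      ⟨fun v => ?_, by omega⟩, fun A => ?_, fun A => ?_⟩
    · rw [hI.arr_rest 7 (by omega)]
      rfl
    · rw [cnt_zero, cnt_zero]
    · rw [cnt_zero, cnt_zero]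
  · simp [Test.cost, Expr.cost]
    omega

end ViolatingCut

namespace ViolatingCut

open WordRAM Prog Expr Test

/-! ### Cuts of the multigraph and cuts of the network -/

section

variable {n m c : ℕ} {G : Graph ℕ ℕ} {X : Set ℕ} {s : State}

theorem IsInput.isLink_iff (hI : IsInput n m c G X s) {e x y : ℕ} :
    G.IsLink e x y ↔ e < m ∧ ((s.arr 0 e = x ∧ s.arr 1 e = y) ∨ (s.arr 0 e = y ∧ s.arr 1 e = x)) := by
  constructor
  · intro h
    have he : e < m := by
      have := h.edge_mem
      rwa [hI.edgeSet_eq] at this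
    exact ⟨he, (hI.isLink e he).eq_and_eq_or_eq_and_eq h⟩
  · rintro ⟨he, ⟨rfl, rfl⟩ | ⟨rfl, rfl⟩⟩
    · exact hI.isLink e he
    · exact (hI.isLink e he).symm

theorem IsInput.ncard_edgesBetween (hI : IsInput n m c G X s) {A B : Set ℕ} (hAB : A ∪ B = X)
    (hd : Disjoint A B) :
    (edgesBetween G A B).ncard = cnt (Crosses (s.arr 0) (s.arr 1) X A) m := by
  rw [← ncard_eq_cnt]
  congr 1
  have hB (x : ℕ) : x ∈ B ↔ x ∈ X ∧ x ∉ A := by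
    rw [← hAB]
    exact ⟨fun h => ⟨Or.inr h, fun h' => Set.disjoint_left.1 hd h' h⟩,
      fun h => h.1.resolve_left h.2⟩
  have hA (x : ℕ) (h : x ∈ A) : x ∈ X := hAB ▸ Or.inl h
  ext e
  constructor
  · rintro ⟨x, hx, y, hy, hl⟩
    obtain ⟨he, ⟨rfl, rfl⟩ | ⟨rfl, rfl⟩⟩ := hI.isLink_iff.1 hl
    · exact ⟨he, hA _ hx, ((hB _).1 hy).1, Or.inl ⟨hx, ((hB _).1 hy).2⟩⟩
    · exact ⟨he, ((hB _).1 hy).1, hA _ hx, Or.inr ⟨hx, ((hB _).1 hy).2⟩⟩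
  · rintro ⟨he, ha, hb, ⟨h1, h2⟩ | ⟨h1, h2⟩⟩
    · exact ⟨_, h1, _, (hB _).2 ⟨hb, h2⟩, hI.isLink_iff.2 ⟨he, Or.inl ⟨rfl, rfl⟩⟩⟩
    · exact ⟨_, h1, _, (hB _).2 ⟨ha, h2⟩, hI.isLink_iff.2 ⟨he, Or.inr ⟨rfl, rfl⟩⟩⟩

theorem IsInput.ncard_boundary_inter (hI : IsInput n m c G X s) {A : Set ℕ} (hA : A ⊆ X) :
    (boundary G A ∩ boundary G X).ncard = cnt (Leaves (s.arr 0) (s.arr 1) X A) m := by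
  rw [← ncard_eq_cnt]
  congr 1
  ext e
  constructor
  · rintro ⟨⟨x, hx, y, hy, hl⟩, ⟨x', hx', y', hy', hl'⟩⟩
    obtain ⟨he, h⟩ := hI.isLink_iff.1 hl
    obtain ⟨-, h'⟩ := hI.isLink_iff.1 hl'
    refine ⟨he, ?_⟩
    have hxX := hA hx
    have hyX : y' ∉ X := hy'.2
    unfold Leaves
    rcases h with ⟨rfl, rfl⟩ | ⟨rfl, rfl⟩ <;> rcases h' with ⟨rfl, rfl⟩ | ⟨rfl, rfl⟩ <;> tauto
  · rintro ⟨he, h⟩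
    have hl := hI.isLink e he
    rcases h with ⟨h1, h2, h3⟩ | ⟨h1, h2, h3⟩
    · exact ⟨⟨_, h3, _, ⟨hl.right_mem, fun h => h2 (hA h)⟩, hl⟩, _, h1, _, ⟨hl.right_mem, h2⟩, hl⟩
    · exact ⟨⟨_, h3, _, ⟨hl.left_mem, fun h => h2 (hA h)⟩, hl.symm⟩, _, h1, _, ⟨hl.left_mem, h2⟩,
        hl.symm⟩

theorem viol_congr {N : Net} (hcut : ∀ A, N.cut A = cnt (Crosses (s.arr 0) (s.arr 1) X A) m)
    (hdem : ∀ A, N.dem A = cnt (Leaves (s.arr 0) (s.arr 1) X A) m) {A A' : Set ℕ} (h : ∀ x ∈ X, (x ∈ A ↔ x ∈ A')) :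
    N.Viol c A ↔ N.Viol c A' := by
  have h1 : N.cut A = N.cut A' := by
    rw [hcut, hcut]
    refine cnt_congr fun e _ => ?_
    have := h (s.arr 0 e)
    have := h (s.arr 1 e)
    unfold Crosses
    tauto
  have h2 : N.dem A = N.dem A' := by
    rw [hdem, hdem]
    refine cnt_congr fun e _ => ?_
    have := h (s.arr 0 e)
    have := h (s.arr 1 e)
    unfold Leaves
    tauto
  have h3 : N.dem Aᶜ = N.dem A'ᶜ := by
    rw [hdem, hdem]
    refine cnt_congr fun e _ => ?_
    have := h (s.arr 0 e)
    have := h (s.arr 1 e)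
    unfold Leaves
    simp only [Set.mem_compl_iff]
    tauto
  unfold Net.Viol
  rw [h1, h2, h3]

theorem IsInput.isViolatingCut_iff (hI : IsInput n m c G X s) {N : Net}
    (hcut : ∀ A, N.cut A = cnt (Crosses (s.arr 0) (s.arr 1) X A) m)
    (hdem : ∀ A, N.dem A = cnt (Leaves (s.arr 0) (s.arr 1) X A) m) {A B : Set ℕ} (hAB : A ∪ B = X)
    (hd : Disjoint A B) : IsViolatingCut G c X A B ↔ N.Viol c A := by
  have h3 : cnt (Leaves (s.arr 0) (s.arr 1) X B) m = N.dem Aᶜ := by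
    rw [hdem]
    refine cnt_congr fun e _ => ?_
    have hB (x : ℕ) (hx : x ∈ X) : x ∈ B ↔ x ∈ Aᶜ := by
      rw [← hAB] at hx
      exact ⟨fun h h' => Set.disjoint_left.1 hd h' h, fun h => hx.resolve_left h⟩
    have := hB (s.arr 0 e)
    have := hB (s.arr 1 e)
    unfold Leaves
    tauto
  unfold IsViolatingCut Net.Viol
  rw [hI.ncard_edgesBetween hAB hd, hI.ncard_boundary_inter (hAB ▸ Set.subset_union_left),
    hI.ncard_boundary_inter (hAB ▸ Set.subset_union_right), h3, ← hcut, ← hdem, lt_min_iff,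
    lt_min_iff]
  tauto

end

/-! ### The running time -/

theorem pow_le_two_pow (c W : ℕ) (hW : W ≤ 2 * c) : (c + 1) ^ (W + c) ≤ (2 ^ c ^ 2) ^ 3 := by
  calc (c + 1) ^ (W + c) ≤ (c + 1) ^ (3 * c) := Nat.pow_le_pow_right (by omega) (by omega)
    _ ≤ (2 ^ c) ^ (3 * c) := Nat.pow_le_pow_left Nat.lt_two_pow_self _
    _ = (2 ^ c ^ 2) ^ 3 := by rw [← pow_mul, ← pow_mul]; congr 1; ring

theorem total_time_le {c k m M W k' B : ℕ} (hM : M ≤ 2 * m) (hk : k ≤ m) (hW : W ≤ 2 * c)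
    (hB : B = (c + 1) ^ (W + c)) (hk' : k' = k) :
    120 * m + 10 + (((20 * M + ((20 * B + 80) * W + (500 * (M + k) + 20 * B + 160) * c) + 50 + 50) *
      (B + 1) + 50) * (k + 1) + 30 + 2) ≤ 2 ^ (20 * (c ^ 2 + 1)) * (max k' 1) ^ 2 * max m 1 := by
  subst hk'
  obtain ⟨D, hD⟩ : ∃ D, D = 2 ^ c ^ 2 := ⟨_, rfl⟩
  have hD1 : 1 ≤ D := hD ▸ Nat.one_le_two_pow
  have hcD : c ≤ D := by
    have h1 : c ≤ c ^ 2 := Nat.le_self_pow (by norm_num) c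
    have h2 : c ^ 2 < 2 ^ c ^ 2 := Nat.lt_two_pow_self
    omega
  have hBD : B ≤ D ^ 3 := by
    rw [hB, hD]
    exact pow_le_two_pow c W hW
  have hD3 : 1 ≤ D ^ 3 := Nat.one_le_pow _ _ hD1
  obtain ⟨m', hm'⟩ : ∃ m', m' = max m 1 := ⟨_, rfl⟩
  obtain ⟨K, hK⟩ : ∃ K, K = max k' 1 := ⟨_, rfl⟩
  have h1 : m ≤ m' ∧ 1 ≤ m' := hm' ▸ ⟨le_max_left _ _, le_max_right _ _⟩
  have h2 : k' ≤ K ∧ 1 ≤ K := hK ▸ ⟨le_max_left _ _, le_max_right _ _⟩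
  rw [← hm', ← hK]
  set E := D ^ 3 * m' with hE
  have hE1 : D ^ 3 ≤ E := Nat.le_mul_of_pos_right _ h1.2
  have hE2 : m' ≤ E := Nat.le_mul_of_pos_left _ hD3
  have t1 : (20 * B + 80) * W ≤ (100 * E) * (2 * D) := Nat.mul_le_mul (by omega) (by omega)
  have t2 : (500 * (M + k') + 20 * B + 160) * c ≤ (1680 * E) * D :=
    Nat.mul_le_mul (by omega) (by omega)
  have hED : E ≤ E * D := Nat.le_mul_of_pos_right _ hD1
  have t3 : 20 * M + ((20 * B + 80) * W + (500 * (M + k') + 20 * B + 160) * c) + 50 + 50 ≤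
      2020 * (E * D) := by
    have e1 : (100 * E) * (2 * D) = 200 * (E * D) := by ring
    have e2 : (1680 * E) * D = 1680 * (E * D) := by ring
    omega
  have t4 : (20 * M + ((20 * B + 80) * W + (500 * (M + k') + 20 * B + 160) * c) + 50 + 50) *
      (B + 1) ≤ 2020 * (E * D) * (2 * D ^ 3) := Nat.mul_le_mul t3 (by omega)
  set F := E * D * D ^ 3 with hF
  have hF1 : E ≤ F := hED.trans (Nat.le_mul_of_pos_right _ hD3)
  have e4 : 2020 * (E * D) * (2 * D ^ 3) = 4040 * F := by rw [hF]; ring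
  have t5 : ((20 * M + ((20 * B + 80) * W + (500 * (M + k') + 20 * B + 160) * c) + 50 + 50) *
      (B + 1) + 50) * (k' + 1) ≤ (4090 * F) * (2 * K) := Nat.mul_le_mul (by omega) (by omega)
  have e5 : (4090 * F) * (2 * K) = 8180 * (F * K) := by ring
  have hFK : F ≤ F * K := Nat.le_mul_of_pos_right _ h2.2
  calc _ ≤ 8400 * (F * K) := by omega
    _ ≤ 2 ^ 20 * (F * K * (D ^ 13 * K)) := by
      refine Nat.mul_le_mul (by norm_num) (Nat.le_mul_of_pos_right _ ?_)
      exact Nat.mul_pos (pow_pos hD1 _) h2.2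
    _ = 2 ^ (20 * (c ^ 2 + 1)) * K ^ 2 * m' := by
      rw [hF, hE, mul_add, pow_add, mul_comm 20 (c ^ 2), pow_mul, ← hD]
      ring

theorem word_bounds {n m c w W : ℕ} (hW : W ≤ 2 * c)
    (hw : 20 * (c ^ 2 + Nat.log 2 (n + m) + 1) ≤ w) :
    6 * m + 2 * c + 4 < 2 ^ w ∧ (c + 1) ^ (W + c) + 1 < 2 ^ w := by
  have hm : m < 2 ^ (Nat.log 2 (n + m) + 1) :=
    (Nat.le_add_left m n).trans_lt (Nat.lt_pow_succ_log_self (by norm_num) _)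
  have h1 : c ≤ c ^ 2 := Nat.le_self_pow (by norm_num) c
  have h2 : c ^ 2 < 2 ^ c ^ 2 := Nat.lt_two_pow_self
  have hB := pow_le_two_pow c W hW
  rw [← pow_mul] at hB
  obtain ⟨L, hL⟩ : ∃ L, L = Nat.log 2 (n + m) + 1 := ⟨_, rfl⟩
  rw [← hL] at hm
  have h3 : 2 ^ (5 + (c ^ 2 * 3 + L)) ≤ 2 ^ w := Nat.pow_le_pow_right (by norm_num) (by omega)
  have h4 : 2 ^ (c ^ 2 * 3) ≤ 2 ^ (c ^ 2 * 3 + L) := Nat.pow_le_pow_right (by norm_num) (by omega)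
  have h5 : 2 ^ L ≤ 2 ^ (c ^ 2 * 3 + L) := Nat.pow_le_pow_right (by norm_num) (by omega)
  have h6 : 2 ^ (c ^ 2) ≤ 2 ^ (c ^ 2 * 3 + L) := Nat.pow_le_pow_right (by norm_num) (by omega)
  have h7 : 2 ^ (5 + (c ^ 2 * 3 + L)) = 32 * 2 ^ (c ^ 2 * 3 + L) := by rw [pow_add]; norm_num
  have h8 : 1 ≤ 2 ^ (c ^ 2 * 3 + L) := Nat.one_le_two_pow
  constructor <;> omega

end ViolatingCut

theorem mainTheorem5 :
    ∃ (p : WordRAM.Prog) (C : ℕ),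
      ∀ (n m c : ℕ) (G : Graph ℕ ℕ) (X : Set ℕ) (s : WordRAM.State) (w : ℕ),
        ViolatingCut.IsInput n m c G X s →
        C * (c ^ 2 + Nat.log 2 (n + m) + 1) ≤ w →
        ∃ (s' : WordRAM.State) (t : ℕ),
          WordRAM.Exec w p s s' t ∧
          t ≤ 2 ^ (C * (c ^ 2 + 1)) * (max (ViolatingCut.boundary G X).ncard 1) ^ 2 * max m 1 ∧
          ((s'.reg 0 = 1 ∧
              ViolatingCut.IsViolatingCut G c X (ViolatingCut.outputSide X s')
                (X \ ViolatingCut.outputSide X s')) ∨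
            (s'.reg 0 = 0 ∧
              ¬ (∃ A B : Set ℕ, ViolatingCut.IsViolatingCut G c X A B) ∧
              ViolatingCut.IsConnectivityLinked G c X)) := by
  refine ⟨ViolatingCut.main, 20, ?_⟩
  intro n m c G X s w hI hw
  have hwm := (ViolatingCut.word_bounds (W := 0) (by omega) hw).1
  obtain ⟨s₁, t₁, hex₁, ht₁, ⟨N, hH, hM, hk, hcut, hdem⟩, hf₁⟩ :=
    (ViolatingCut.prepare_spec (w := w) hI (by omega)).frame
  have hwB := (ViolatingCut.word_bounds (W := min N.k (2 * c)) (min_le_right _ _) hw).2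
  have z3 (x) : s₁.arr 3 x = 0 := by
    rw [hf₁.2 3 (by decide)]
    exact hI.arr_rest 3 le_rfl x
  have z12 (x) : s₁.arr 12 x = 0 := by
    rw [hf₁.2 12 (by decide)]
    exact hI.arr_rest 12 (by omega) x
  have z17 : s₁.reg 17 = 0 := by
    rw [hf₁.1 17 (by decide)]
    exact hI.reg_rest 17 (by omega)
  have z15 : s₁.reg 15 = 0 := by
    rw [hf₁.1 15 (by decide)]
    exact hI.reg_rest 15 (by omega)
  obtain ⟨s₂, t₂, hex₂, ht₂, hpost⟩ :=
    ViolatingCut.windows_spec (w := w) (by omega) hwB hH z3 z12 z17 z15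
  have hbd : (ViolatingCut.boundary G X).ncard = N.k := by
    have h1 := hI.ncard_boundary_inter (A := X) subset_rfl
    rw [Set.inter_self, ← hdem] at h1
    rw [h1, ← N.dem_add_compl X, Nat.left_eq_add, hdem]
    by_contra h0
    obtain ⟨e, -, he⟩ := ViolatingCut.exists_of_cnt_pos (Nat.pos_of_ne_zero h0)
    unfold ViolatingCut.Leaves at he
    simp only [Set.mem_compl_iff] at he
    tauto
  refine ⟨s₂.setReg 0 (s₂.reg 15), t₁ + (t₂ + 2), ?_, ?_, ?_⟩
  · exact .seq hex₁ (.seq hex₂ (.assign _ _ _))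
  · refine le_trans ?_ (ViolatingCut.total_time_le hM hk (min_le_right N.k (2 * c)) rfl hbd)
    unfold ViolatingCut.attemptTime at ht₂
    omega
  · rcases hpost with ⟨h15, hviol, hle⟩ | ⟨h15, hno⟩
    · left
      refine ⟨by simp [h15], ?_⟩
      have hsub : ViolatingCut.outputSide X (s₂.setReg 0 (s₂.reg 15)) ⊆ X := fun v hv => hv.1
      rw [hI.isViolatingCut_iff hcut hdem (Set.union_sdiff_cancel hsub) Set.disjoint_sdiff_right]
      refine (ViolatingCut.viol_congr hcut hdem fun x hx => ?_).2 hviol.compl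
      have := hle x
      have h1 : x ∈ ViolatingCut.outputSide X (s₂.setReg 0 (s₂.reg 15)) ↔ s₂.arr 3 x = 1 :=
        ⟨fun h => h.2, fun h => ⟨hx, h⟩⟩
      rw [h1]
      change _ ↔ ¬ (s₂.arr 3 x = 0)
      omega
    · right
      have key : ∀ A B, ¬ ViolatingCut.IsViolatingCut G c X A B := fun A B h =>
        hno A ((hI.isViolatingCut_iff hcut hdem h.1 h.2.1).1 h)
      refine ⟨by simp [h15], fun ⟨A, B, h⟩ => key A B h, fun A B h1 h2 => ?_⟩
      by_contra! hc
      exact key A B ⟨h1, h2, hc⟩
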